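/- **Setting.** Let $\mathcal X$ be an input space, $P_x$ a probability law on $\mathcal X$, $\Phi$ a class of measurable feature maps $\phi:\mathcal X\to\mathbb R^p$ (pointwise separable: some countable $\Phi_0\subseteq\Phi$ is such that every $\phi\in\Phi$ is a pointwise limit of a sequence in $\Phi_0$), $\mathcal W\subseteq\mathbb R^p$ a set of linear predictors $z\mapsto\langle w,z\rangle$, and $\ell:\mathbb R\times\mathbb R\to\mathbb R_{\ge0}$ a measurable loss. There are $D$ domains with true predictors $w_1^*,\dots,w_D^*$ and a common true feature map $\phi^*$; in domain $t$ the law $\mathcal D_t$ of $(x,y)$ is $x\sim P_x$ and $y\sim P_{y}(\cdot\mid\langle w_t^*,\phi^*(x)\rangle)$ for one common conditional law. Write $L_t(w\circ\phi)=\mathbb E_{\mathcal D_t}\,\ell(\langle w,\phi(x)\rangle,y)$. **Regularity assumptions.** (1) $w_t^*\in\mathcal W$ for all $t\in[D]$, $\phi^*\in\Phi$, and $w_t^*\circ\phi^*$ is the unique (up to $P_x$-null sets) minimizer of $L_t$ over $\{w\circ\phi: w\in\mathcal W,\phi\in\Phi\}$; (2) $0\le\ell\le B$, and $\ell(\cdot,y)$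 is $L$-Lipschitz for every $y$; (3) $\|w\|_2\le W$ for $w\in\mathcal W$; (4) $\sup_x\|\phi(x)\|_2\le D_{\mathcal X}$ for $\phi\in\Phi$; (5) for some $\lambda>0$ and all $t\in[D]$, $w\mapsto L_t(w\circ\phi^*)$ is $\lambda$-strongly convex on the (convex) set $\mathcal W$. **Diversity.** Fix $T\ge1$ source domains, relabelled $1,\dots,T$. For $\phi'\in\Phi$ put $$\bar d(\phi')=\frac1T\sum_{t=1}^T\inf_{w'\in\mathcal W}\mathbb E_{\mathcal D_t}\big[\ell(w'\circ\phi')-\ell(w^*_t\circ\phi^*)\big],\qquad d(\phi')=\sup_{t\in[D]}\sup_{w\in\mathcal W}\big|\mathbb E_{\mathcal D_t}[\ell(w\circ\phi')-\ell(w\circ\phi^*)]\big|,$$ the suprema in $d$ being over all $D$ domains. The source predictors are $(\nu,\epsilon)$-diverse for $\phi^*$ if $d(\phi')\le\bar d(\phi')/\nu+\epsilon$ for all $\phi'\in\Phi$. **Complexities.** For a class $F$ of $\mathbb R^q$-valued functions and points $X=(x_1,\dots,x_N)$ let $\widehat{\mathfrak G}_N(F_{|X})=\mathbb E_g\sup_{f\in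 F}\frac1N\sum_{i=1}^N\sum_{k=1}^q g_{ki}f_k(x_i)$ with $g_{ki}$ i.i.d. standard Gaussian. Let $\mathfrak G_N(\Phi)=\mathbb E_X\widehat{\mathfrak G}_N(\Phi_{|X})$ for $N$ i.i.d. points from $P_x$, and let $\overline{\mathfrak G}_n(\mathcal W)=\sup\widehat{\mathfrak G}_n(\mathcal W_{|Z})$ over all $Z=(\phi(x_1),\dots,\phi(x_n))$ with $\phi\in\Phi$, $x_i\in\mathcal X$. **Theorem.** There is an absolute constant $C>0$ with the following property. Let the regularity assumptions hold, let the predictors $w_1^*,\dots,w_T^*$ of the source domains be $(\nu,\epsilon)$-diverse for $\phi^*$ with $\nu>0$, let $n\ge1$ and $0<\delta<1$. Draw $n$ i.i.d. samples $(x_{t,i},y_{t,i})$ from each source domain $\mathcal D_t$, independently. Then with probability at least $1-\delta$, every joint empirical risk minimizer $(\hat w_1,\dots,\hat w_T,\hat\phi)\in\mathcal W^T\times\Phi$ of $\frac1{nT}\sum_{t=1}^T\sum_{i=1}^n\ell(\langle w_t,\phi(x_{t,i})\rangle,y_{t,i})$ satisfies $$\frac1T\sum_{t=1}^T\|\hat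 w_t-w_t^*\|_2\le C\sqrt{\frac2\lambda}\,\Big(\big(1+\tfrac1\nu\big)\,\mathcal E+\epsilon\Big)^{1/2},$$ $$\mathcal E=L\Big[\frac{W D_{\mathcal X}}{(nT)^2}+\log(nT)\big(W\,\mathfrak G_{nT}(\Phi)+\overline{\mathfrak G}_n(\mathcal W)\big)\Big]+8B\sqrt{\frac{\log(2/\delta)}{nT}}.$$ In particular, for $\epsilon=0$ and fixed $\nu$ the average distance is $O\big(\sqrt{2/\lambda}\;\mathcal E^{1/2}\big)$. -/

import Mathlib

open MeasureTheory ProbabilityTheory Filter Topology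

noncomputable section

/-! ### Gaussian complexity -/

/-- Empirical Gaussian complexity of a class `F` of `ℝ^q`-valued functions at the points
`X 0, …, X (N-1)`: the expectation, over independent standard Gaussians `g (i, k)`, of
`sup_{f ∈ F} (1/N) ∑ i, ∑ k, g (i, k) * f_k (X i)`. -/
def empGaussianComplexity {α : Type*} {q N : ℕ} (F : Set (α → EuclideanSpace ℝ (Fin q)))
    (X : Fin N → α) : ℝ :=
  ∫ g : Fin N × Fin q → ℝ,
    (⨆ f : F, (1 / (N : ℝ)) * ∑ i : Fin N, ∑ k : Fin q, g (i, k) * f.1 (X i) k)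
    ∂(Measure.pi fun _ : Fin N × Fin q => gaussianReal 0 1)

/-- Expected Gaussian complexity: the points are `N` i.i.d. draws from `Px`. -/
def gaussianComplexity {α : Type*} [MeasurableSpace α] (Px : Measure α) {q : ℕ} (N : ℕ)
    (F : Set (α → EuclideanSpace ℝ (Fin q))) : ℝ :=
  ∫ X : Fin N → α, empGaussianComplexity F X ∂(Measure.pi fun _ : Fin N => Px)

/-- A set of vectors `w ∈ ℝ^p`, seen as the class of linear functionals `z ↦ ⟪w, z⟫`
(with values in `ℝ^1`). -/
def linearClass {p : ℕ} (W : Set (EuclideanSpace ℝ (Fin p))) :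
    Set (EuclideanSpace ℝ (Fin p) → EuclideanSpace ℝ (Fin 1)) :=
  (fun w z => WithLp.toLp 2 (fun _ : Fin 1 => inner ℝ w z)) '' W

/-- Worst-case Gaussian complexity of the linear functionals `W` over all the point sets
`(φ (x 0), …, φ (x (n-1)))` with `φ ∈ Φ` and `x i` in the input space. -/
def worstGaussianComplexity {α : Type*} {p : ℕ} (n : ℕ) (W : Set (EuclideanSpace ℝ (Fin p)))
    (Φ : Set (α → EuclideanSpace ℝ (Fin p))) : ℝ :=
  ⨆ Z : Φ × (Fin n → α), empGaussianComplexity (linearClass W) (fun i => Z.1.1 (Z.2 i))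

/-! ### The multi-domain model -/

/-- The usual measurability requirement on a function class: some countable subclass is dense
in it for pointwise convergence of sequences (so suprema over the class are measurable). -/
def PointwiseSeparable {α : Type*} {p : ℕ} (Φ : Set (α → EuclideanSpace ℝ (Fin p))) : Prop :=
  ∃ Φ₀ ⊆ Φ, Φ₀.Countable ∧ ∀ φ ∈ Φ, ∃ u : ℕ → α → EuclideanSpace ℝ (Fin p),
    (∀ k, u k ∈ Φ₀) ∧ ∀ x, Tendsto (fun k => u k x) atTop (𝓝 (φ x))

/-- The data of the learning problem with input space `𝒳`, `D` domains and features in `ℝ^p`. -/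
structure DomainModel (𝒳 : Type*) [MeasurableSpace 𝒳] (D p : ℕ) where
  /-- the common law of the inputs -/
  Px : Measure 𝒳
  isProb : IsProbabilityMeasure Px
  /-- `label u` is the law of `y` given that the true score of the input equals `u` -/
  label : Kernel ℝ ℝ
  isMarkov : IsMarkovKernel label
  /-- the linear predictors, identified with vectors -/
  W : Set (EuclideanSpace ℝ (Fin p))
  /-- the feature maps -/
  Φ : Set (𝒳 → EuclideanSpace ℝ (Fin p))
  measurable_of_mem : ∀ φ ∈ Φ, Measurable φ
  separable : PointwiseSeparable Φ
  /-- the true domain-specific linear predictors -/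
  wStar : Fin D → EuclideanSpace ℝ (Fin p)
  /-- the true feature map -/
  φStar : 𝒳 → EuclideanSpace ℝ (Fin p)
  measurable_φStar : Measurable φStar
  /-- the loss `ℓ (prediction) (label)` -/
  loss : ℝ → ℝ → ℝ
  measurable_loss : Measurable (Function.uncurry loss)

namespace DomainModel

variable {𝒳 : Type*} [MeasurableSpace 𝒳] {D p : ℕ} (m : DomainModel 𝒳 D p)

/-- The law of `(x, y)` in domain `t`: `x` is drawn from `Px`, and then `y` from
`label ⟪wStar t, φStar x⟫`. -/
def law (t : Fin D) : Measure (𝒳 × ℝ) :=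
  m.Px.compProd
    (m.label.comap (fun x => inner ℝ (m.wStar t) (m.φStar x))
      (m.measurable_φStar.const_inner))

/-- The expected loss of the predictor `x ↦ ⟪w, φ x⟫` in domain `t`. -/
def risk (t : Fin D) (w : EuclideanSpace ℝ (Fin p)) (φ : 𝒳 → EuclideanSpace ℝ (Fin p)) : ℝ :=
  ∫ z, m.loss (inner ℝ w (φ z.1)) z.2 ∂(m.law t)

/-- The regularity assumptions, with constants `B`, `L`, `Wbd` (bound on the predictors),
`DX` (bound on the features) and `lam` (strong convexity). -/
structure Regular (B L Wbd DX lam : ℝ) : Prop where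
  /-- realizability -/
  wStar_mem : ∀ t, m.wStar t ∈ m.W
  φStar_mem : m.φStar ∈ m.Φ
  /-- `⟪wStar t, φStar ·⟫` minimizes the expected loss of domain `t` … -/
  isMin : ∀ t, ∀ w ∈ m.W, ∀ φ ∈ m.Φ, m.risk t (m.wStar t) m.φStar ≤ m.risk t w φ
  /-- … and is the only minimizer, up to null sets of inputs -/
  isMin_unique : ∀ t, ∀ w ∈ m.W, ∀ φ ∈ m.Φ, m.risk t w φ = m.risk t (m.wStar t) m.φStar →
    (fun x => inner ℝ w (φ x)) =ᵐ[m.Px] (fun x => inner ℝ (m.wStar t) (m.φStar x))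
  loss_nonneg : ∀ u y, 0 ≤ m.loss u y
  loss_le : ∀ u y, m.loss u y ≤ B
  loss_lipschitz : ∀ u u' y, |m.loss u y - m.loss u' y| ≤ L * |u - u'|
  norm_le : ∀ w ∈ m.W, ‖w‖ ≤ Wbd
  feature_le : ∀ φ ∈ m.Φ, ∀ x, ‖φ x‖ ≤ DX
  lam_pos : 0 < lam
  strongConvex : ∀ t, StrongConvexOn m.W lam (fun w => m.risk t w m.φStar)

/-- Task-average representation difference of `φ'` from `φ`, on the source domains
`src 0, …, src (T-1)` with predictors `w 0, …, w (T-1)`. -/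
def tard {T : ℕ} (src : Fin T → Fin D) (w : Fin T → EuclideanSpace ℝ (Fin p))
    (φ' φ : 𝒳 → EuclideanSpace ℝ (Fin p)) : ℝ :=
  (1 / (T : ℝ)) * ∑ t : Fin T, ⨅ w' : m.W,
    ∫ z, (m.loss (inner ℝ w'.1 (φ' z.1)) z.2 - m.loss (inner ℝ (w t) (φ z.1)) z.2)
      ∂(m.law (src t))

/-- Uniform absolute representation difference of `φ'` from `φ`: the supremum runs over all
`D` domains. -/
def uard (φ' φ : 𝒳 → EuclideanSpace ℝ (Fin p)) : ℝ :=
  ⨆ t : Fin D, ⨆ w : m.W,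
    |∫ z, (m.loss (inner ℝ w.1 (φ' z.1)) z.2 - m.loss (inner ℝ w.1 (φ z.1)) z.2) ∂(m.law t)|

/-- `w 0, …, w (T-1)` is `(ν, ε)`-diverse for `φ`. -/
def Diverse {T : ℕ} (src : Fin T → Fin D) (w : Fin T → EuclideanSpace ℝ (Fin p))
    (φ : 𝒳 → EuclideanSpace ℝ (Fin p)) (ν ε : ℝ) : Prop :=
  ∀ φ' ∈ m.Φ, m.uard φ' φ ≤ m.tard src w φ' φ / ν + ε

/-- The law of the training sample: independent draws, `n` of them from each source domain. -/
def sampleLaw {T : ℕ} (src : Fin T → Fin D) (n : ℕ) : Measure (Fin T × Fin n → 𝒳 × ℝ) :=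
  Measure.pi fun j : Fin T × Fin n => m.law (src j.1)

/-- The joint empirical risk on the sample `S`. -/
def empRisk {T n : ℕ} (S : Fin T × Fin n → 𝒳 × ℝ) (w : Fin T → EuclideanSpace ℝ (Fin p))
    (φ : 𝒳 → EuclideanSpace ℝ (Fin p)) : ℝ :=
  (1 / ((n : ℝ) * T)) * ∑ t : Fin T, ∑ i : Fin n,
    m.loss (inner ℝ (w t) (φ (S (t, i)).1)) (S (t, i)).2

/-- `(w, φ)` is a joint empirical risk minimizer on the sample `S`. -/
def IsERM {T n : ℕ} (S : Fin T × Fin n → 𝒳 × ℝ) (w : Fin T → EuclideanSpace ℝ (Fin p))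
    (φ : 𝒳 → EuclideanSpace ℝ (Fin p)) : Prop :=
  (∀ t, w t ∈ m.W) ∧ φ ∈ m.Φ ∧
    ∀ w' : Fin T → EuclideanSpace ℝ (Fin p), (∀ t, w' t ∈ m.W) → ∀ φ' ∈ m.Φ,
      m.empRisk S w φ ≤ m.empRisk S w' φ'

end DomainModel

end

/-! Write the excess risk of a predictor as its risk minus the risk of the truth. Strong convexity
bounds `‖wHat t - wStar t‖²` by `2 / lam` times the excess risk of `wHat t` over the true features.
Replacing the true features by `φHat` costs at most `uard`, and diversity bounds that by `tard / ν +
ε`. Since `tard` is an infimum over predictors, it is at most the average excess risk of the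
minimizer. So `1 + 1 / ν` times the average excess risk, plus `ε`, controls the mean squared
distance, and Cauchy–Schwarz passes to the mean distance (`avg_norm_sub_le`). It remains to bound
the average excess risk by a constant times `𝓔`.

By minimality of the empirical risk, the excess risk is at most a difference of deviations
(`excess_le_deviation`). McDiarmid's inequality concentrates the supremum of these differences about
its mean, and symmetrization bounds the mean by a Rademacher average of the losses
(`integral_iSup_sub_le_of_signAvg_le`).

The Rademacher average is bounded by chaining. Sudakov minoration turns Gaussian widths into nets:
the score vectors are covered by netting the features and then, at each net feature, the tuples of
linear predictors (`exists_net_taskScoreVec`). The log-cardinality grows like `4 ^ j` at radius `2 ^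
(-j)`, so every dyadic scale contributes the same amount to the chain (`signAvg_iSup_le`). About `2
log₂ (nT)` scales produce the factor `log (nT)`, and stopping there leaves the remainder `W D_𝒳 /
(nT)²`. The loss is only used through its Lipschitz bound on the links of the chain, so no separate
contraction principle is required.

Sudakov minoration itself comes from a packing argument in Gauss space: translates of a symmetric
set of measure at least `3/4` along separated directions are disjoint, while a translate loses at
most the factor `exp (-‖a‖² / 2)` (`exp_mul_gaussPi_le`, `card_le_of_separated`). -/

/-! ### Gaussian width of a bounded family of vectors -/

/-- The law of a standard Gaussian vector with coordinates indexed by `ι`. -/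
noncomputable abbrev gaussPi (ι : Type*) [Fintype ι] : Measure (ι → ℝ) :=
  Measure.pi fun _ : ι => gaussianReal 0 1

/-- The support function `g ↦ sup_k ⟪g, v k⟫` of a family of vectors. -/
noncomputable def supportFun {κ ι : Type*} [Fintype ι] (v : κ → EuclideanSpace ℝ ι)
    (g : ι → ℝ) : ℝ :=
  ⨆ k, ∑ i, g i * v k i

/-- The Gaussian width `E sup_k ⟪g, v k⟫`. -/
noncomputable def gaussWidth {κ ι : Type*} [Fintype ι] (v : κ → EuclideanSpace ℝ ι) : ℝ :=
  ∫ g, supportFun v g ∂gaussPi ι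

/-- Used both to relabel samples and Gaussians and to restrict a product law to the block of one
task. -/
theorem measurePreserving_pi_comp {ι ι' Ω : Type*} [Fintype ι] [Fintype ι'] [MeasurableSpace Ω]
    (μ : ι → Measure Ω) [∀ i, IsProbabilityMeasure (μ i)] {e : ι' → ι}
    (he : Function.Injective e) :
    MeasurePreserving (fun (g : ι → Ω) i' => g (e i')) (Measure.pi μ)
      (Measure.pi fun i' => μ (e i')) := by
  refine ⟨by fun_prop, ?_⟩
  have h1 : iIndepFun (fun i (ω : ι → Ω) => ω i) (Measure.pi μ) :=
    iIndepFun_pi (X := fun i => (id : Ω → Ω)) (fun i => aemeasurable_id)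
  have h2 := h1.precomp he
  rw [iIndepFun_iff_map_fun_eq_pi_map (fun i => (measurable_pi_apply _).aemeasurable)] at h2
  rw [h2]
  congr 1
  funext i
  exact (measurePreserving_eval μ (e i)).map_eq

section Width

variable {κ ι : Type*} [Fintype ι] {v : κ → EuclideanSpace ℝ ι} {R : ℝ}

theorem abs_sum_mul_le_of_norm_le (hv : ∀ k, ‖v k‖ ≤ R) (g : ι → ℝ) (k : κ) :
    |∑ i, g i * v k i| ≤ R * ∑ i, |g i| := by
  refine (Finset.abs_sum_le_sum_abs _ _).trans ?_
  rw [Finset.mul_sum]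
  refine Finset.sum_le_sum fun i _ => ?_
  rw [abs_mul, mul_comm]
  gcongr
  exact (PiLp.norm_apply_le (v k) i).trans (hv k)

theorem bddAbove_range_sum_mul (hv : ∀ k, ‖v k‖ ≤ R) (g : ι → ℝ) :
    BddAbove (Set.range fun k => ∑ i, g i * v k i) :=
  ⟨R * ∑ i, |g i|, by
    rintro _ ⟨k, rfl⟩
    exact (abs_le.1 (abs_sum_mul_le_of_norm_le hv g k)).2⟩

theorem le_supportFun (hv : ∀ k, ‖v k‖ ≤ R) (g : ι → ℝ) (k : κ) :
    ∑ i, g i * v k i ≤ supportFun v g :=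
  le_ciSup (bddAbove_range_sum_mul hv g) k

/-- The family may be uncountable; a supremum of continuous functions is still lower semicontinuous.
-/
theorem measurable_supportFun (hv : ∀ k, ‖v k‖ ≤ R) : Measurable (supportFun v) := by
  have : LowerSemicontinuous (fun g : ι → ℝ => ⨆ k, ∑ i, g i * v k i) :=
    lowerSemicontinuous_ciSup (bddAbove_range_sum_mul hv)
      (fun k => Continuous.lowerSemicontinuous (by fun_prop))
  exact this.measurable

theorem abs_supportFun_le [Nonempty κ] (hv : ∀ k, ‖v k‖ ≤ R) (g : ι → ℝ) :
    |supportFun v g| ≤ R * ∑ i, |g i| := by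
  obtain ⟨k⟩ := ‹Nonempty κ›
  have : Nonempty κ := ⟨k⟩
  rw [abs_le]
  exact ⟨(abs_le.1 (abs_sum_mul_le_of_norm_le hv g k)).1.trans (le_supportFun hv g k),
    ciSup_le fun k => (abs_le.1 (abs_sum_mul_le_of_norm_le hv g k)).2⟩

theorem integrable_eval_gaussPi (i : ι) : Integrable (fun g : ι → ℝ => g i) (gaussPi ι) := by
  have h : Integrable (fun x : ℝ => x) (gaussianReal 0 1) :=
    (memLp_id_gaussianReal 1).integrable le_rfl
  exact (measurePreserving_eval (fun _ : ι => gaussianReal 0 1) i).integrable_comp_of_integrable h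

theorem integrable_sum_abs_gaussPi :
    Integrable (fun g : ι → ℝ => ∑ i, |g i|) (gaussPi ι) :=
  integrable_finsetSum _ fun i _ => (integrable_eval_gaussPi i).abs

theorem integrable_supportFun [Nonempty κ] (hv : ∀ k, ‖v k‖ ≤ R) :
    Integrable (supportFun v) (gaussPi ι) := by
  refine Integrable.mono' (integrable_sum_abs_gaussPi.const_mul R)
    (measurable_supportFun hv).aestronglyMeasurable (.of_forall fun g => ?_)
  exact abs_supportFun_le hv g

theorem measurePreserving_neg_gaussPi :
    MeasurePreserving (fun g : ι → ℝ => -g) (gaussPi ι) (gaussPi ι) := by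
  refine measurePreserving_pi (f := fun _ (x : ℝ) => -x) _ _ fun i => ⟨by fun_prop, ?_⟩
  simpa using gaussianReal_map_neg (μ := 0) (v := 1)

theorem gaussWidth_nonneg [Nonempty κ] (hv : ∀ k, ‖v k‖ ≤ R) : 0 ≤ gaussWidth v := by
  obtain ⟨k⟩ := ‹Nonempty κ›
  have : Nonempty κ := ⟨k⟩
  have h : ∫ g, (∑ i, g i * v k i) ∂gaussPi ι = 0 := by
    rw [integral_finsetSum _ fun i _ => (integrable_eval_gaussPi i).mul_const _]
    refine Finset.sum_eq_zero fun i _ => ?_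
    rw [integral_mul_const]
    have h0 : ∫ g : ι → ℝ, g i ∂gaussPi ι = ∫ x, x ∂gaussianReal 0 1 := by
      rw [← (measurePreserving_eval (fun _ : ι => gaussianReal 0 1) i).map_eq,
        integral_map (measurable_pi_apply i).aemeasurable (by fun_prop)]
    rw [h0, integral_id_gaussianReal, zero_mul]
  rw [← h]
  exact integral_mono (integrable_finsetSum _ fun i _ => (integrable_eval_gaussPi i).mul_const _)
    (integrable_supportFun hv) (fun g => le_supportFun hv g k)

theorem gaussWidth_le [Nonempty κ] (hv : ∀ k, ‖v k‖ ≤ R) :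
    gaussWidth v ≤ R * ∫ g, ∑ i, |g i| ∂gaussPi ι := by
  rw [← integral_const_mul]
  exact integral_mono (integrable_supportFun hv) (integrable_sum_abs_gaussPi.const_mul R)
    fun g => (abs_le.1 (abs_supportFun_le hv g)).2

/-- Markov's inequality at level `8 * w`: the symmetrized support function is nonnegative with mean
`2 * gaussWidth v ≤ 2 * w`. The symmetrization makes the set invariant under `g ↦ -g`. -/
theorem le_gaussPi_of_width_le [Nonempty κ] (hv : ∀ k, ‖v k‖ ≤ R) {w : ℝ} (hw : 0 < w)
    (hvw : gaussWidth v ≤ w) :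
    3 / 4 ≤ (gaussPi ι).real {g | supportFun v g + supportFun v (-g) < 8 * w} := by
  have hi := integrable_supportFun hv
  have hi' : Integrable (fun g => supportFun v (-g)) (gaussPi ι) :=
    measurePreserving_neg_gaussPi.integrable_comp_of_integrable hi
  have hE : ∫ g, (supportFun v g + supportFun v (-g)) ∂gaussPi ι = 2 * gaussWidth v := by
    rw [integral_add hi hi']
    have : ∫ g, supportFun v (-g) ∂gaussPi ι = gaussWidth v := by
      rw [gaussWidth, ← measurePreserving_neg_gaussPi.map_eq, integral_map (by fun_prop)
        ((measurable_supportFun hv).aestronglyMeasurable), measurePreserving_neg_gaussPi.map_eq]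
    rw [this, gaussWidth]; ring
  have h0 : ∀ g, 0 ≤ supportFun v g + supportFun v (-g) := fun g => by
    obtain ⟨k⟩ := ‹Nonempty κ›
    have h1 := le_supportFun hv g k
    have h2 := le_supportFun hv (-g) k
    simp only [Pi.neg_apply, neg_mul, Finset.sum_neg_distrib] at h2
    linarith
  have hM := mul_meas_ge_le_integral_of_nonneg (.of_forall h0) (hi.add hi') (8 * w)
  change _ ≤ ∫ g, (supportFun v g + supportFun v (-g)) ∂gaussPi ι at hM
  rw [hE] at hM
  have hms : MeasurableSet {g | supportFun v g + supportFun v (-g) < 8 * w} :=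
    measurableSet_lt ((measurable_supportFun hv).add
      ((measurable_supportFun hv).comp measurable_neg)) measurable_const
  have hc := probReal_compl_eq_one_sub (μ := gaussPi ι) hms
  have he : {g | supportFun v g + supportFun v (-g) < 8 * w}ᶜ =
      {g | 8 * w ≤ supportFun v g + supportFun v (-g)} := by ext; simp
  rw [he] at hc
  change 8 * w * (gaussPi ι).real {g | 8 * w ≤ supportFun v g + supportFun v (-g)} ≤ _ at hM
  rw [hc] at hM
  nlinarith

end Width

/-! ### Shifts of the Gaussian measure -/

theorem gaussianReal_eq_withDensity (a : ℝ) :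
    gaussianReal a 1 =
      (gaussianReal 0 1).withDensity fun x => ENNReal.ofReal (Real.exp (a * x - a ^ 2 / 2)) := by
  rw [gaussianReal_of_var_ne_zero _ one_ne_zero, gaussianReal_of_var_ne_zero _ one_ne_zero,
    ← withDensity_mul _ (measurable_gaussianPDF 0 1) (by fun_prop)]
  congr 1
  funext x
  simp only [gaussianPDF, Pi.mul_apply]
  rw [← ENNReal.ofReal_mul (gaussianPDFReal_nonneg _ _ _)]
  congr 1
  simp only [gaussianPDFReal]
  rw [mul_assoc _ (Real.exp _) (Real.exp _), ← Real.exp_add]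
  congr 2
  simp
  ring

/-- The Cameron–Martin formula in finite dimension, obtained coordinatewise and tested on boxes. -/
theorem gaussPi_map_add {ι : Type*} [Fintype ι] (a : ι → ℝ) :
    (gaussPi ι).map (fun g => g + a) =
      (gaussPi ι).withDensity fun g => ∏ i, ENNReal.ofReal (Real.exp (a i * g i - a i ^ 2 / 2)) := by
  have h1 : (gaussPi ι).map (fun g => g + a) = Measure.pi fun i => gaussianReal (a i) 1 := by
    have := Measure.pi_map_pi (μ := fun _ : ι => gaussianReal 0 1) (f := fun i x => x + a i)
      (hμ := fun i => by rw [gaussianReal_map_add_const]; infer_instance) (fun i => by fun_prop)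
    simp only [gaussianReal_map_add_const, zero_add] at this
    exact this
  rw [h1]
  refine Measure.pi_eq fun s hs => ?_
  rw [withDensity_apply _ (MeasurableSet.univ_pi hs),
    ← lintegral_indicator (MeasurableSet.univ_pi hs)]
  have h2 : ∀ g : ι → ℝ, (Set.univ.pi s).indicator
      (fun g => ∏ i, ENNReal.ofReal (Real.exp (a i * g i - a i ^ 2 / 2))) g =
      ∏ i, (s i).indicator (fun x => ENNReal.ofReal (Real.exp (a i * x - a i ^ 2 / 2))) (g i) := by
    intro g
    by_cases hg : g ∈ Set.univ.pi s
    · rw [Set.indicator_of_mem hg]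
      exact Finset.prod_congr rfl fun i _ => by rw [Set.indicator_of_mem (hg i trivial)]
    · rw [Set.indicator_of_notMem hg]
      obtain ⟨i, hi⟩ : ∃ i, g i ∉ s i := by simpa [Set.mem_pi] using hg
      exact (Finset.prod_eq_zero (Finset.mem_univ i) (Set.indicator_of_notMem hi _)).symm
  simp_rw [h2]
  have hm : ∀ i, Measurable
      ((s i).indicator (fun x => ENNReal.ofReal (Real.exp (a i * x - a i ^ 2 / 2)))) :=
    fun i => Measurable.indicator (by fun_prop) (hs i)
  rw [lintegral_prod_eq_prod_lintegral_of_indepFun Finset.univ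
    (fun i (g : ι → ℝ) => (s i).indicator
      (fun x => ENNReal.ofReal (Real.exp (a i * x - a i ^ 2 / 2))) (g i))
    (iIndepFun_pi fun i => (hm i).aemeasurable) (fun i => (hm i).comp (measurable_pi_apply i))]
  refine Finset.prod_congr rfl fun i _ => ?_
  rw [gaussianReal_eq_withDensity (a i), withDensity_apply _ (hs i), ← lintegral_indicator (hs i),
    ← (measurePreserving_eval (fun _ : ι => gaussianReal 0 1) i).lintegral_comp (hm i)]

/-- By symmetry of `K` the Cameron–Martin density may be averaged over `g` and `-g`, which gives
`exp (-‖a‖² / 2) * cosh ⟪a, g⟫`, and `cosh ≥ 1`. -/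
theorem exp_mul_gaussPi_le {ι : Type*} [Fintype ι] (a : ι → ℝ) {K : Set (ι → ℝ)}
    (hK : MeasurableSet K) (hsymm : ∀ g ∈ K, -g ∈ K) :
    Real.exp (-(∑ i, a i ^ 2) / 2) * (gaussPi ι).real K ≤
      (gaussPi ι).real {g | g - a ∈ K} := by
  set f : (ι → ℝ) → ENNReal := fun g => ∏ i, ENNReal.ofReal (Real.exp (-a i * g i - a i ^ 2 / 2))
    with hf
  have hfm : Measurable f := by fun_prop
  have h1 : (gaussPi ι) {g | g - a ∈ K} = ∫⁻ g in K, f g ∂gaussPi ι := by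
    rw [← withDensity_apply _ hK]
    have := gaussPi_map_add (-a)
    simp only [Pi.neg_apply, neg_sq] at this
    rw [← this, Measure.map_apply (by fun_prop) hK]
    simp only [← sub_eq_add_neg]
    rfl
  have h2 : ∫⁻ g in K, f (-g) ∂gaussPi ι = ∫⁻ g in K, f g ∂gaussPi ι := by
    rw [← lintegral_indicator hK, ← lintegral_indicator hK,
      ← measurePreserving_neg_gaussPi.lintegral_comp (hfm.indicator hK)]
    refine lintegral_congr fun g => ?_
    by_cases hg : g ∈ K
    · rw [Set.indicator_of_mem hg, Set.indicator_of_mem (hsymm g hg)]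
    · rw [Set.indicator_of_notMem hg, Set.indicator_of_notMem fun h => hg (by simpa using hsymm _ h)]
  have hprod : ∀ g : ι → ℝ, f g =
      ENNReal.ofReal (Real.exp (-(∑ i, a i ^ 2) / 2 - ∑ i, a i * g i)) := by
    intro g
    rw [hf]
    simp only
    rw [← ENNReal.ofReal_prod_of_nonneg fun i _ => (Real.exp_pos _).le, ← Real.exp_sum]
    congr 2
    rw [Finset.sum_sub_distrib, ← Finset.sum_div]
    simp only [neg_mul, Finset.sum_neg_distrib]
    ring
  have h3 : ENNReal.ofReal (2 * Real.exp (-(∑ i, a i ^ 2) / 2)) * gaussPi ι K ≤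
      2 * gaussPi ι {g | g - a ∈ K} := by
    rw [two_mul (gaussPi ι {g | g - a ∈ K}), h1]
    nth_rewrite 2 [← h2]
    rw [← lintegral_add_left hfm, ← setLIntegral_const]
    refine lintegral_mono fun g => ?_
    rw [hprod, hprod, ← ENNReal.ofReal_add (Real.exp_pos _).le (Real.exp_pos _).le]
    refine ENNReal.ofReal_le_ofReal ?_
    simp only [Pi.neg_apply, mul_neg, Finset.sum_neg_distrib, sub_neg_eq_add]
    rw [sub_eq_add_neg, Real.exp_add, Real.exp_add, ← mul_add, mul_comm 2]
    gcongr
    have := Real.one_le_cosh (∑ i, a i * g i)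
    rw [Real.cosh_eq] at this
    linarith
  have h4 := ENNReal.toReal_mono (by finiteness) h3
  rw [ENNReal.toReal_mul, ENNReal.toReal_mul, ENNReal.toReal_ofReal (by positivity)] at h4
  simp only [ENNReal.toReal_ofNat] at h4
  simp only [Measure.real]
  linarith

/-! ### Sudakov minoration -/

section Sudakov

variable {κ ι : Type*} [Fintype ι] {v : κ → EuclideanSpace ℝ ι} {R : ℝ}

/-- Packing of the translates `K + lam (v k - t)`. Restricting to a ball of radius `2 * ε` keeps the
translations short, of length at most `32 * w / ε`, so the measure lost depends on `w / ε` only. -/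
theorem card_le_of_separated [Nonempty κ] (hv : ∀ k, ‖v k‖ ≤ R) {w : ℝ} (hw : 0 < w)
    (hvw : gaussWidth v ≤ w) {ε : ℝ} (hε : 0 < ε) (t : EuclideanSpace ℝ ι) (F : Finset κ)
    (hF : ∀ k ∈ F, ‖v k - t‖ ≤ 2 * ε) (hsep : ∀ k ∈ F, ∀ l ∈ F, k ≠ l → ε < ‖v k - v l‖) :
    (F.card : ℝ) ≤ Real.exp (1024 * w ^ 2 / ε ^ 2) := by
  rcases Nat.lt_or_ge F.card 2 with h2 | h2
  · have h1 : (F.card : ℝ) ≤ 1 := by exact_mod_cast Nat.lt_succ_iff.1 h2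
    exact h1.trans (Real.one_le_exp (by positivity))
  -- Chosen so that `lam * ε ^ 2 = 16 * w`, the sum of the two thresholds `8 * w` available at a
  -- common point of two translates.
  set lam : ℝ := 16 * w / ε ^ 2 with hlam
  have hlam0 : 0 < lam := by positivity
  set K : Set (ι → ℝ) := {g | supportFun v g + supportFun v (-g) < 8 * w} with hKdef
  have hKm : MeasurableSet K := measurableSet_lt ((measurable_supportFun hv).add
      ((measurable_supportFun hv).comp measurable_neg)) measurable_const
  have hKs : ∀ g ∈ K, -g ∈ K := fun g hg => by
    simp only [hKdef, Set.mem_ofPred_eq, neg_neg] at hg ⊢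
    linarith
  set a : κ → ι → ℝ := fun k i => lam * (v k - t) i with ha
  set A : κ → Set (ι → ℝ) := fun k => {g | g - a k ∈ K} with hA
  have hAm : ∀ k, MeasurableSet (A k) := fun k => hKm.preimage (by fun_prop)
  have hdisj : Set.PairwiseDisjoint (↑F) A := by
    intro k hk l hl hkl
    refine Set.disjoint_left.2 fun g hgk hgl => ?_
    have e1 := le_supportFun hv (g - a l) k
    have e2 := le_supportFun hv (-(g - a l)) l
    have e3 := le_supportFun hv (g - a k) l
    have e4 := le_supportFun hv (-(g - a k)) k
    simp only [hA, hKdef, Set.mem_ofPred_eq] at hgk hgl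
    have hs := hsep k hk l hl hkl
    have hn : ‖v k - v l‖ ^ 2 = ∑ i, (v k i - v l i) ^ 2 := by
      rw [EuclideanSpace.norm_sq_eq]; simp
    -- This is `⟪a k - a l, v k - v l⟫`, with `g` cancelling; each of the four sums is at most a
    -- support function.
    have key : lam * ‖v k - v l‖ ^ 2 =
        (∑ i, (g - a l) i * v k i) + (∑ i, (-(g - a l)) i * v l i) +
        (∑ i, (g - a k) i * v l i) + ∑ i, (-(g - a k)) i * v k i := by
      rw [hn, Finset.mul_sum, ← Finset.sum_add_distrib, ← Finset.sum_add_distrib,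
        ← Finset.sum_add_distrib]
      refine Finset.sum_congr rfl fun i _ => ?_
      simp only [ha, Pi.sub_apply, Pi.neg_apply, PiLp.sub_apply]
      ring
    have h16 : lam * ε ^ 2 = 16 * w := by rw [hlam]; field_simp
    have : lam * ε ^ 2 < lam * ‖v k - v l‖ ^ 2 := by gcongr
    linarith
  have hmeas : ∀ k ∈ F, Real.exp (-(512 * w ^ 2 / ε ^ 2)) * (3 / 4) ≤ (gaussPi ι).real (A k) := by
    intro k hk
    refine le_trans ?_ (exp_mul_gaussPi_le (a k) hKm hKs)
    have hsum : ∑ i, a k i ^ 2 = lam ^ 2 * ‖v k - t‖ ^ 2 := by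
      rw [EuclideanSpace.norm_sq_eq, Finset.mul_sum]
      refine Finset.sum_congr rfl fun i _ => ?_
      rw [ha, Real.norm_eq_abs, sq_abs]; ring
    have hle : ∑ i, a k i ^ 2 ≤ 1024 * w ^ 2 / ε ^ 2 := by
      rw [hsum]
      calc lam ^ 2 * ‖v k - t‖ ^ 2 ≤ lam ^ 2 * (2 * ε) ^ 2 := by gcongr; exact hF k hk
        _ = 1024 * w ^ 2 / ε ^ 2 := by rw [hlam]; field_simp; ring
    refine mul_le_mul (Real.exp_le_exp.2 ?_) (le_gaussPi_of_width_le hv hw hvw) (by norm_num)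
      (Real.exp_pos _).le
    have : 1024 * w ^ 2 / ε ^ 2 = 2 * (512 * w ^ 2 / ε ^ 2) := by ring
    linarith
  have hone : (F.card : ℝ) * (Real.exp (-(512 * w ^ 2 / ε ^ 2)) * (3 / 4)) ≤ 1 := by
    calc (F.card : ℝ) * (Real.exp (-(512 * w ^ 2 / ε ^ 2)) * (3 / 4))
        = ∑ k ∈ F, Real.exp (-(512 * w ^ 2 / ε ^ 2)) * (3 / 4) := by simp
      _ ≤ ∑ k ∈ F, (gaussPi ι).real (A k) := Finset.sum_le_sum hmeas
      _ = (gaussPi ι).real (⋃ k ∈ F, A k) :=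
          (measureReal_biUnion_finset hdisj fun k _ => hAm k).symm
      _ ≤ 1 := measureReal_le_one
  -- Disjointness gives `F.card ≤ (4/3) X`. As `F.card ≥ 2`, this forces `X ≥ 3/2`, so `(4/3) X ≤ X
  -- ^ 2`: doubling the exponent absorbs the `4/3`.
  set X := Real.exp (512 * w ^ 2 / ε ^ 2) with hX
  have hXX : Real.exp (1024 * w ^ 2 / ε ^ 2) = X * X := by
    rw [hX, ← Real.exp_add]; congr 1; ring
  have hX0 : 0 < X := Real.exp_pos _
  rw [Real.exp_neg, ← hX] at hone
  have h3 : (F.card : ℝ) * (3 / 4) ≤ X := by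
    have := mul_le_mul_of_nonneg_right hone hX0.le
    field_simp at this
    linarith
  have h2' : (2 : ℝ) ≤ F.card := by exact_mod_cast h2
  rw [hXX]
  nlinarith

/-- A separated set of maximal cardinality is a net; the packing bound ensures that a maximum
exists. -/
theorem exists_local_net [Nonempty κ] (hv : ∀ k, ‖v k‖ ≤ R) {w : ℝ} (hw : 0 < w)
    (hvw : gaussWidth v ≤ w) {ε : ℝ} (hε : 0 < ε) (t : EuclideanSpace ℝ ι) :
    ∃ F : Finset κ, (F.card : ℝ) ≤ Real.exp (1024 * w ^ 2 / ε ^ 2) ∧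
      ∀ k, ‖v k - t‖ ≤ 2 * ε → ∃ l ∈ F, ‖v k - v l‖ ≤ ε := by
  classical
  set P : Set ℕ := {n | ∃ F : Finset κ, F.card = n ∧ (∀ k ∈ F, ‖v k - t‖ ≤ 2 * ε) ∧
    ∀ k ∈ F, ∀ l ∈ F, k ≠ l → ε < ‖v k - v l‖} with hP
  have hne : P.Nonempty := ⟨0, ∅, by simp⟩
  have hbd : BddAbove P := by
    refine ⟨⌊Real.exp (1024 * w ^ 2 / ε ^ 2)⌋₊, ?_⟩
    rintro n ⟨F, rfl, h1, h2⟩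
    exact Nat.le_floor (card_le_of_separated hv hw hvw hε t F h1 h2)
  obtain ⟨F, hcard, h1, h2⟩ := Nat.sSup_mem hne hbd
  refine ⟨F, card_le_of_separated hv hw hvw hε t F h1 h2, fun k hk => ?_⟩
  by_contra! hcon
  have hkF : k ∉ F := fun h => by
    have := hcon k h
    simp only [sub_self, norm_zero] at this
    linarith
  have hmem : F.card + 1 ∈ P := by
    refine ⟨insert k F, Finset.card_insert_of_notMem hkF, ?_, ?_⟩
    · intro l hl
      rcases Finset.mem_insert.1 hl with rfl | hl
      · exact hk
      · exact h1 l hl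
    · intro l hl l' hl' hne'
      rcases Finset.mem_insert.1 hl with e | hl <;> rcases Finset.mem_insert.1 hl' with e' | hl'
      · exact absurd (e.trans e'.symm) hne'
      · rw [e]; exact hcon l' hl'
      · rw [e', norm_sub_rev]; exact hcon l hl
      · exact h2 l hl l' hl' hne'
  have := le_csSup hbd hmem
  omega

/-- **Sudakov minoration** at dyadic scales: a family of vectors of norm at most `R` and Gaussian
width at most `w` has nets of radius `2 R / 2 ^ j` and cardinality `exp (512 w² 4 ^ j / R²)`. -/
theorem exists_dyadic_net [Nonempty κ] (hv : ∀ k, ‖v k‖ ≤ R) (hR : 0 < R) {w : ℝ} (hw : 0 < w)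
    (hvw : gaussWidth v ≤ w) (j : ℕ) :
    ∃ F : Finset κ, (F.card : ℝ) ≤ Real.exp (512 * w ^ 2 / R ^ 2 * 4 ^ j) ∧
      ∀ k, ∃ l ∈ F, ‖v k - v l‖ ≤ 2 * R / 2 ^ j := by
  classical
  induction j with
  | zero =>
    obtain ⟨k₀⟩ := ‹Nonempty κ›
    refine ⟨{k₀}, by simpa using by positivity, fun k => ⟨k₀, by simp, ?_⟩⟩
    have := norm_sub_le (v k) (v k₀)
    have h1 := hv k
    have h2 := hv k₀
    simp only [pow_zero, div_one]
    linarith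
  | succ j ih =>
    obtain ⟨F, hF, hcov⟩ := ih
    have hε : 0 < 2 * R / 2 ^ (j + 1) := by positivity
    -- The old radius is twice the new one, so a local net around each old centre suffices. Its
    -- exponent is twice the old total, and `1 + 2 ≤ 4` closes the induction.
    choose N hN hN' using fun f : κ => exists_local_net hv hw hvw hε (v f)
    refine ⟨F.biUnion N, ?_, fun k => ?_⟩
    · calc ((F.biUnion N).card : ℝ) ≤ ∑ f ∈ F, ((N f).card : ℝ) := by
            exact_mod_cast Finset.card_biUnion_le
        _ ≤ ∑ f ∈ F, Real.exp (1024 * w ^ 2 / (2 * R / 2 ^ (j + 1)) ^ 2) :=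
            Finset.sum_le_sum fun f _ => hN f
        _ = F.card * Real.exp (1024 * w ^ 2 / (2 * R / 2 ^ (j + 1)) ^ 2) := by simp
        _ ≤ Real.exp (512 * w ^ 2 / R ^ 2 * 4 ^ j) *
            Real.exp (1024 * w ^ 2 / (2 * R / 2 ^ (j + 1)) ^ 2) := by gcongr
        _ ≤ _ := by
            rw [← Real.exp_add, Real.exp_le_exp]
            have e : (2 * R / 2 ^ (j + 1)) ^ 2 = R ^ 2 / 4 ^ j := by
              have h4 : ((2 : ℝ) ^ j) ^ 2 = 4 ^ j := by
                rw [← pow_mul, mul_comm, pow_mul]; norm_num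
              rw [pow_succ 2 j, ← h4]
              field_simp
            rw [e, pow_succ 4 j]
            have : 1024 * w ^ 2 / (R ^ 2 / 4 ^ j) = 2 * (512 * w ^ 2 / R ^ 2 * 4 ^ j) := by
              field_simp; norm_num
            rw [this]
            have : 0 ≤ 512 * w ^ 2 / R ^ 2 * 4 ^ j := by positivity
            linarith
    · obtain ⟨f, hf, hkf⟩ := hcov k
      obtain ⟨l, hl, hkl⟩ := hN' f k (hkf.trans_eq (by rw [pow_succ]; field_simp))
      exact ⟨l, Finset.mem_biUnion.2 ⟨f, hf, hl⟩, hkl⟩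

end Sudakov

/-! ### Random signs and chaining -/

/-- The sign `±1` encoded by a Boolean. -/
def sgn (b : Bool) : ℝ := if b then 1 else -1

theorem abs_sgn (b : Bool) : |sgn b| = 1 := by cases b <;> simp [sgn]

theorem sgn_not (b : Bool) : sgn (!b) = -sgn b := by cases b <;> simp [sgn]

/-- The average of a function over all choices of signs. -/
noncomputable def signAvg {ι : Type*} [Fintype ι] [DecidableEq ι] (f : (ι → Bool) → ℝ) : ℝ :=
  (∑ σ, f σ) / 2 ^ Fintype.card ι

/-- The optimization in a Chernoff bound, at `l = √(2 * b) / s`; the degenerate cases `b = 0` and `s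
= 0` need another `l`. -/
theorem le_mul_sqrt_of_forall_le {x b s : ℝ} (hb : 0 ≤ b) (hs : 0 ≤ s)
    (h : ∀ l : ℝ, 0 < l → l * x ≤ b + l ^ 2 * s ^ 2 / 2) : x ≤ s * √(2 * b) := by
  rcases hb.eq_or_lt with rfl | hb
  · rw [mul_zero, Real.sqrt_zero, mul_zero]
    by_contra! hx
    have hl : 0 < x / (s ^ 2 + 1) := by positivity
    have := h _ hl
    have e : x / (s ^ 2 + 1) * x - (x / (s ^ 2 + 1)) ^ 2 * s ^ 2 / 2 =
        x ^ 2 * (s ^ 2 + 2) / (2 * (s ^ 2 + 1) ^ 2) := by field_simp; ring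
    have : 0 < x ^ 2 * (s ^ 2 + 2) / (2 * (s ^ 2 + 1) ^ 2) := by positivity
    linarith
  rcases hs.eq_or_lt with rfl | hs
  · rw [zero_mul]
    by_contra! hx
    have := h (2 * b / x) (by positivity)
    rw [div_mul_cancel₀ _ hx.ne'] at this
    norm_num at this
    linarith
  · set q := √(2 * b) with hq
    have hq0 : 0 < q := Real.sqrt_pos.2 (by positivity)
    have hqq : q ^ 2 = 2 * b := Real.sq_sqrt (by positivity)
    have := h (q / s) (by positivity)
    have e : b + (q / s) ^ 2 * s ^ 2 / 2 = q / s * (s * q) := by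
      field_simp; linarith
    rw [e] at this
    exact le_of_mul_le_mul_left this (by positivity)

theorem abs_sum_sgn_mul_le {ι : Type*} [Fintype ι] (σ : ι → Bool) (a : ι → ℝ) :
    |∑ i, sgn (σ i) * a i| ≤ ∑ i, |a i| := by
  refine (Finset.abs_sum_le_sum_abs _ _).trans (Finset.sum_le_sum fun i _ => ?_)
  rw [abs_mul, abs_sgn, one_mul]

theorem sum_abs_le_sqrt_card_mul {ι : Type*} [Fintype ι] (x : EuclideanSpace ℝ ι) :
    ∑ i, |x i| ≤ √(Fintype.card ι) * ‖x‖ := by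
  have h := Real.sum_mul_le_sqrt_mul_sqrt Finset.univ (fun _ : ι => (1 : ℝ)) fun i => |x i|
  simpa [EuclideanSpace.norm_eq] using h

section Signs

variable {ι : Type*} [Fintype ι] [DecidableEq ι]

theorem signAvg_mono {f g : (ι → Bool) → ℝ} (h : ∀ σ, f σ ≤ g σ) : signAvg f ≤ signAvg g := by
  unfold signAvg
  gcongr
  exact h _

theorem signAvg_add (f g : (ι → Bool) → ℝ) :
    signAvg (fun σ => f σ + g σ) = signAvg f + signAvg g := by
  simp [signAvg, Finset.sum_add_distrib, add_div]

theorem signAvg_const (c : ℝ) : signAvg (fun _ : ι → Bool => c) = c := by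
  simp [signAvg]

theorem signAvg_mul_left (c : ℝ) (f : (ι → Bool) → ℝ) :
    signAvg (fun σ => c * f σ) = c * signAvg f := by
  simp [signAvg, ← Finset.mul_sum, mul_div_assoc]

theorem signAvg_finset_sum {τ : Type*} (F : Finset τ) (f : τ → (ι → Bool) → ℝ) :
    signAvg (fun σ => ∑ k ∈ F, f k σ) = ∑ k ∈ F, signAvg (f k) := by
  simp only [signAvg]
  rw [Finset.sum_comm, Finset.sum_div]

theorem signAvg_comp_not (f : (ι → Bool) → ℝ) :
    signAvg (fun σ => f fun i => !σ i) = signAvg f := by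
  unfold signAvg
  congr 1
  exact Function.Involutive.bijective (f := fun (σ : ι → Bool) i => !σ i)
    (fun σ => by simp) |>.sum_comp f

/-- The average factors into `∏ cosh (a i)`, and `cosh x ≤ exp (x² / 2)`. -/
theorem signAvg_exp_le (a : ι → ℝ) :
    signAvg (fun σ => Real.exp (∑ i, sgn (σ i) * a i)) ≤ Real.exp ((∑ i, a i ^ 2) / 2) := by
  have h1 : ∑ σ : ι → Bool, Real.exp (∑ i, sgn (σ i) * a i) = ∏ i, (2 * Real.cosh (a i)) := by
    simp_rw [Real.exp_sum]
    have := Finset.prod_univ_sum (fun _ : ι => (Finset.univ : Finset Bool))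
      (fun i b => Real.exp (sgn b * a i))
    rw [Fintype.piFinset_univ] at this
    rw [← this]
    refine Finset.prod_congr rfl fun i _ => ?_
    rw [Real.cosh_eq]
    simp [sgn]
    ring
  unfold signAvg
  rw [h1, Finset.prod_mul_distrib, Finset.prod_const, Finset.card_univ, mul_div_cancel_left₀ _
    (by positivity), Finset.sum_div, Real.exp_sum]
  exact Finset.prod_le_prod (fun i _ => (Real.cosh_pos _).le)
    fun i _ => Real.cosh_le_exp_half_sq _

theorem exp_signAvg_le (f : (ι → Bool) → ℝ) :
    Real.exp (signAvg f) ≤ signAvg (fun σ => Real.exp (f σ)) := by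
  have h := convexOn_exp.map_sum_le (t := Finset.univ)
    (w := fun _ : ι → Bool => (1 : ℝ) / 2 ^ Fintype.card ι) (p := f)
    (fun _ _ => by positivity) (by simp) (fun _ _ => trivial)
  simp only [smul_eq_mul, ← Finset.mul_sum] at h
  simpa [signAvg, div_eq_inv_mul] using h

/-- Massart's finite class lemma: Jensen for the exponential, then a union bound in which the
maximum is replaced by the sum. -/
theorem signAvg_sup'_le {τ : Type*} (F : Finset τ) (hF : F.Nonempty) (a : τ → ι → ℝ) {s b : ℝ}
    (hs : 0 ≤ s) (hb : 0 ≤ b) (ha : ∀ k ∈ F, ∑ i, a k i ^ 2 ≤ s ^ 2)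
    (hcard : (F.card : ℝ) ≤ Real.exp b) :
    signAvg (fun σ => F.sup' hF fun k => ∑ i, sgn (σ i) * a k i) ≤ s * √(2 * b) := by
  refine le_mul_sqrt_of_forall_le hb hs fun l hl => ?_
  rw [← Real.exp_le_exp, ← signAvg_mul_left]
  refine (exp_signAvg_le _).trans ?_
  calc signAvg (fun σ => Real.exp (l * F.sup' hF fun k => ∑ i, sgn (σ i) * a k i))
      ≤ signAvg (fun σ => ∑ k ∈ F, Real.exp (∑ i, sgn (σ i) * (l * a k i))) := by
        refine signAvg_mono fun σ => ?_
        obtain ⟨k, hk, he⟩ := F.exists_mem_eq_sup' hF fun k => ∑ i, sgn (σ i) * a k i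
        rw [he]
        have e : l * ∑ i, sgn (σ i) * a k i = ∑ i, sgn (σ i) * (l * a k i) := by
          rw [Finset.mul_sum]; exact Finset.sum_congr rfl fun i _ => by ring
        rw [e]
        exact Finset.single_le_sum (f := fun k => Real.exp (∑ i, sgn (σ i) * (l * a k i)))
          (fun k _ => (Real.exp_pos _).le) hk
    _ = ∑ k ∈ F, signAvg (fun σ => Real.exp (∑ i, sgn (σ i) * (l * a k i))) :=
        signAvg_finset_sum _ _
    _ ≤ ∑ k ∈ F, Real.exp (l ^ 2 * s ^ 2 / 2) := by
        refine Finset.sum_le_sum fun k hk => (signAvg_exp_le _).trans ?_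
        rw [Real.exp_le_exp]
        have : ∑ i, (l * a k i) ^ 2 = l ^ 2 * ∑ i, a k i ^ 2 := by
          rw [Finset.mul_sum]; exact Finset.sum_congr rfl fun i _ => by ring
        rw [this]
        gcongr
        exact ha k hk
    _ = F.card * Real.exp (l ^ 2 * s ^ 2 / 2) := by simp
    _ ≤ Real.exp b * Real.exp (l ^ 2 * s ^ 2 / 2) := by gcongr
    _ = _ := by rw [← Real.exp_add]

/-- Chaining for a Rademacher process composed with coordinatewise Lipschitz functions. -/
theorem signAvg_iSup_le {κ : Type*} [Nonempty κ] (h : κ → EuclideanSpace ℝ ι) (ψ : ι → ℝ → ℝ)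
    {L a r : ℝ} (hL : 0 ≤ L) (ha : 0 ≤ a) (hr : 0 ≤ r)
    (hψ : ∀ i u u', |ψ i u - ψ i u'| ≤ L * |u - u'|)
    (hnet : ∀ j : ℕ, ∃ F : Finset (EuclideanSpace ℝ ι), (F.card : ℝ) ≤ Real.exp (a ^ 2 * 4 ^ j) ∧
      ∀ k, ∃ f ∈ F, ‖h k - f‖ ≤ r / 2 ^ j) (h0 : ∃ c, ∀ k, ‖h k - c‖ ≤ r) (J : ℕ) :
    signAvg (fun σ => ⨆ k, ∑ i, sgn (σ i) * ψ i (h k i)) ≤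
      L * (5 * a * r * J + √(Fintype.card ι) * r / 2 ^ J) := by
  classical
  obtain ⟨c, hc⟩ := h0
  choose N hN hN' using hnet
  -- Scale `0` is a single point, so every chain starts at `c` and the starting term averages to
  -- zero.
  set F : ℕ → Finset (EuclideanSpace ℝ ι) := fun j => if j = 0 then {c} else N j with hFdef
  have hFcard : ∀ j, ((F j).card : ℝ) ≤ Real.exp (a ^ 2 * 4 ^ j) := by
    intro j
    by_cases hj : j = 0
    · simp only [hFdef, hj, if_true, Finset.card_singleton]
      exact_mod_cast Real.one_le_exp (by positivity)
    · simp only [hFdef, hj, if_false]; exact hN j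
  have hFcov : ∀ j k, ∃ f ∈ F j, ‖h k - f‖ ≤ r / 2 ^ j := by
    intro j k
    by_cases hj : j = 0
    · subst hj; exact ⟨c, by simp [hFdef], by simpa using hc k⟩
    · simp only [hFdef, hj, if_false]; exact hN' j k
  choose π hπ hπ' using hFcov
  set lip : EuclideanSpace ℝ ι × EuclideanSpace ℝ ι → ι → ℝ :=
    fun q i => ψ i (q.2 i) - ψ i (q.1 i) with hlip
  -- The factor `3 / 2` is `1 + 1 / 2`, from the radii at scales `j` and `j + 1`.
  set links : ℕ → Finset (EuclideanSpace ℝ ι × EuclideanSpace ℝ ι) := fun j =>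
    (F j ×ˢ F (j + 1)).filter fun q => ‖q.2 - q.1‖ ≤ 3 / 2 * (r / 2 ^ j) with hlinks
  have hmem : ∀ j k, (π j k, π (j + 1) k) ∈ links j := by
    intro j k
    rw [hlinks, Finset.mem_filter]
    refine ⟨Finset.mk_mem_product (hπ j k) (hπ (j + 1) k), ?_⟩
    have e : π (j + 1) k - π j k = (h k - π j k) - (h k - π (j + 1) k) := by abel
    rw [e]
    refine (norm_sub_le _ _).trans ((add_le_add (hπ' j k) (hπ' (j + 1) k)).trans_eq ?_)
    rw [pow_succ]; field_simp; norm_num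
  have hne : ∀ j, (links j).Nonempty := fun j => ⟨_, hmem j (Classical.arbitrary κ)⟩
  have hlink : ∀ j, signAvg (fun σ => (links j).sup' (hne j)
      fun q => ∑ i, sgn (σ i) * lip q i) ≤ 5 * L * a * r := by
    intro j
    have hs : ∀ q ∈ links j, ∑ i, lip q i ^ 2 ≤ (3 / 2 * L * (r / 2 ^ j)) ^ 2 := by
      intro q hq
      have hq2 := (Finset.mem_filter.1 hq).2
      calc ∑ i, lip q i ^ 2 ≤ ∑ i, L ^ 2 * ((q.2 - q.1) i) ^ 2 := by
            refine Finset.sum_le_sum fun i _ => ?_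
            rw [← sq_abs, ← sq_abs ((q.2 - q.1) i), ← mul_pow]
            gcongr
            exact hψ i _ _
        _ = (L * ‖q.2 - q.1‖) ^ 2 := by
            rw [mul_pow, EuclideanSpace.norm_sq_eq, Finset.mul_sum]; simp
        _ ≤ (3 / 2 * L * (r / 2 ^ j)) ^ 2 := by
            rw [mul_comm (3 / 2 : ℝ), mul_assoc]
            gcongr
    have hb : ((links j).card : ℝ) ≤ Real.exp (5 * (a ^ 2 * 4 ^ j)) := by
      calc ((links j).card : ℝ) ≤ ((F j).card : ℝ) * (F (j + 1)).card := by
            exact_mod_cast (Finset.card_filter_le _ _).trans (Finset.card_product _ _).le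
        _ ≤ Real.exp (a ^ 2 * 4 ^ j) * Real.exp (a ^ 2 * 4 ^ (j + 1)) :=
            mul_le_mul (hFcard j) (hFcard (j + 1)) (by positivity) (Real.exp_pos _).le
        _ = _ := by rw [← Real.exp_add, pow_succ]; ring_nf
    -- The powers `2 ^ j` of link length and root entropy cancel, leaving `3/2 * √10 ≤ 5` at every
    -- scale.
    refine (signAvg_sup'_le (links j) (hne j) lip (by positivity) (by positivity) hs hb).trans ?_
    have e : √(2 * (5 * (a ^ 2 * 4 ^ j))) = √10 * (a * 2 ^ j) := by
      have : 2 * (5 * (a ^ 2 * 4 ^ j)) = 10 * (a * 2 ^ j) ^ 2 := by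
        have h4 : ((2 : ℝ) ^ j) ^ 2 = 4 ^ j := by rw [← pow_mul, mul_comm, pow_mul]; norm_num
        rw [mul_pow, h4]; ring
      rw [this, Real.sqrt_mul (by norm_num), Real.sqrt_sq (by positivity)]
    rw [e]
    have h10 : √10 ≤ 10 / 3 := Real.sqrt_le_iff.2 ⟨by norm_num, by norm_num⟩
    calc 3 / 2 * L * (r / 2 ^ j) * (√10 * (a * 2 ^ j)) = 3 / 2 * √10 * (L * a * r) := by
          field_simp
      _ ≤ 3 / 2 * (10 / 3) * (L * a * r) := by gcongr
      _ = _ := by ring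
  have hpt : ∀ σ : ι → Bool, (⨆ k, ∑ i, sgn (σ i) * ψ i (h k i)) ≤
      ∑ i, sgn (σ i) * ψ i (c i) + ∑ j ∈ Finset.range J, (links j).sup' (hne j)
        (fun q => ∑ i, sgn (σ i) * lip q i) + L * (√(Fintype.card ι) * r / 2 ^ J) := by
    intro σ
    refine ciSup_le fun k => ?_
    have htel : ∑ i, sgn (σ i) * ψ i (π J k i) - ∑ i, sgn (σ i) * ψ i (π 0 k i) =
        ∑ j ∈ Finset.range J, ∑ i, sgn (σ i) * lip (π j k, π (j + 1) k) i := by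
      rw [← Finset.sum_range_sub (fun j => ∑ i, sgn (σ i) * ψ i (π j k i)) J]
      refine Finset.sum_congr rfl fun j _ => ?_
      rw [← Finset.sum_sub_distrib]
      exact Finset.sum_congr rfl fun i _ => by simp only [hlip]; ring
    have hπ0 : π 0 k = c := by simpa [hFdef] using hπ 0 k
    have h1 : ∑ j ∈ Finset.range J, ∑ i, sgn (σ i) * lip (π j k, π (j + 1) k) i ≤
        ∑ j ∈ Finset.range J, (links j).sup' (hne j) (fun q => ∑ i, sgn (σ i) * lip q i) :=
      Finset.sum_le_sum fun j _ =>
        Finset.le_sup' (fun q => ∑ i, sgn (σ i) * lip q i) (hmem j k)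
    have h2 : ∑ i, sgn (σ i) * ψ i (h k i) - ∑ i, sgn (σ i) * ψ i (π J k i) ≤
        L * (√(Fintype.card ι) * r / 2 ^ J) := by
      rw [← Finset.sum_sub_distrib]
      simp_rw [← mul_sub]
      refine (le_abs_self _).trans ((abs_sum_sgn_mul_le σ _).trans ?_)
      calc ∑ i, |ψ i (h k i) - ψ i (π J k i)| ≤ ∑ i, L * |(h k - π J k) i| :=
            Finset.sum_le_sum fun i _ => hψ i _ _
        _ = L * ∑ i, |(h k - π J k) i| := by rw [Finset.mul_sum]
        _ ≤ L * (√(Fintype.card ι) * (r / 2 ^ J)) := by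
            gcongr
            exact (sum_abs_le_sqrt_card_mul _).trans (by gcongr; exact hπ' J k)
        _ = _ := by ring
    rw [hπ0] at htel
    linarith
  -- The maximal inequality for a single vector, with `b = 0`.
  have hc0 : signAvg (fun σ => ∑ i, sgn (σ i) * ψ i (c i)) ≤ 0 := by
    have := signAvg_sup'_le ({()} : Finset Unit) (by simp) (fun _ i => ψ i (c i))
      (Real.sqrt_nonneg (∑ i, ψ i (c i) ^ 2)) le_rfl
      (fun _ _ => by rw [Real.sq_sqrt (Finset.sum_nonneg fun i _ => sq_nonneg _)]) (by simp)
    simpa using this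
  refine (signAvg_mono hpt).trans ?_
  rw [signAvg_add, signAvg_add, signAvg_const, signAvg_finset_sum (Finset.range J)]
  have hsum : ∑ j ∈ Finset.range J, signAvg (fun σ => (links j).sup' (hne j)
      fun q => ∑ i, sgn (σ i) * lip q i) ≤ J * (5 * L * a * r) := by
    refine (Finset.sum_le_sum fun j _ => hlink j).trans_eq (by simp)
  linarith

end Signs

/-! ### Gaussian complexities as widths -/

theorem norm_le_sqrt_card_mul {ι : Type*} [Fintype ι] {x : EuclideanSpace ℝ ι} {c : ℝ}
    (hc : 0 ≤ c) (hx : ∀ i, |x i| ≤ c) : ‖x‖ ≤ √(Fintype.card ι) * c := by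
  rw [EuclideanSpace.norm_eq, ← Real.sqrt_sq hc, ← Real.sqrt_mul (by positivity)]
  refine Real.sqrt_le_sqrt ?_
  calc ∑ i, ‖x i‖ ^ 2 ≤ ∑ _i : ι, c ^ 2 :=
        Finset.sum_le_sum fun i _ => by rw [Real.norm_eq_abs]; gcongr; exact hx i
    _ = _ := by simp

/-- The vector of all the coordinates of `φ (x j)`, for a finite family of points `x j`. -/
noncomputable def featureVec {α J : Type*} [Fintype J] {p : ℕ} (x : J → α)
    (φ : α → EuclideanSpace ℝ (Fin p)) : EuclideanSpace ℝ (J × Fin p) :=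
  WithLp.toLp 2 fun q => φ (x q.1) q.2

/-- The vector of the scores `⟪w, z j⟫`, for a finite family of points `z j`. -/
noncomputable def scoreVec {J : Type*} [Fintype J] {p : ℕ} (z : J → EuclideanSpace ℝ (Fin p))
    (w : EuclideanSpace ℝ (Fin p)) : EuclideanSpace ℝ J :=
  WithLp.toLp 2 fun j => inner ℝ w (z j)

/-- The vector of the scores `⟪w t, φ (x (t, i))⟫` of all tasks. -/
noncomputable def taskScoreVec {α : Type*} {T n p : ℕ} (x : Fin T × Fin n → α)
    (φ : α → EuclideanSpace ℝ (Fin p)) (w : Fin T → EuclideanSpace ℝ (Fin p)) :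
    EuclideanSpace ℝ (Fin T × Fin n) :=
  WithLp.toLp 2 fun j => inner ℝ (w j.1) (φ (x j))

theorem norm_featureVec_sub_sq {α J : Type*} [Fintype J] {p : ℕ} (x : J → α)
    (φ φ' : α → EuclideanSpace ℝ (Fin p)) :
    ‖featureVec x φ - featureVec x φ'‖ ^ 2 = ∑ j, ‖φ (x j) - φ' (x j)‖ ^ 2 := by
  simp [EuclideanSpace.norm_sq_eq, featureVec, Fintype.sum_prod_type]

theorem norm_featureVec_le {α J : Type*} [Fintype J] {p : ℕ} (x : J → α)
    {φ : α → EuclideanSpace ℝ (Fin p)} {DX : ℝ} (hDX : 0 ≤ DX) (hφ : ∀ x, ‖φ x‖ ≤ DX) :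
    ‖featureVec x φ‖ ≤ √(Fintype.card J) * DX := by
  refine le_of_sq_le_sq ?_ (by positivity)
  rw [mul_pow, Real.sq_sqrt (by positivity)]
  calc ‖featureVec x φ‖ ^ 2 = ∑ j, ‖φ (x j)‖ ^ 2 := by
        simp [EuclideanSpace.norm_sq_eq, featureVec, Fintype.sum_prod_type]
    _ ≤ ∑ _j : J, DX ^ 2 := Finset.sum_le_sum fun j _ => by gcongr; exact hφ _
    _ = _ := by simp

theorem abs_inner_le_of_norm_le {E : Type*} [NormedAddCommGroup E] [InnerProductSpace ℝ E]
    {w z : E} {Wb Db : ℝ} (hw : ‖w‖ ≤ Wb) (hz : ‖z‖ ≤ Db) : |inner ℝ w z| ≤ Wb * Db :=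
  (abs_real_inner_le_norm w z).trans
    (mul_le_mul hw hz (norm_nonneg _) ((norm_nonneg _).trans hw))

/-- The complexity is indexed by `Fin N` and the sample by tasks and draws; the i.i.d. Gaussian law
does not see the relabelling `ρ`. -/
theorem gaussWidth_featureVec {α J : Type*} [Fintype J] {p N : ℕ} (hN : 0 < N) (ρ : Fin N ≃ J)
    (x : J → α) (Φ : Set (α → EuclideanSpace ℝ (Fin p))) {DX : ℝ} (hDX : 0 ≤ DX)
    (hΦ : ∀ φ ∈ Φ, ∀ x, ‖φ x‖ ≤ DX) :
    gaussWidth (fun φ : Φ => featureVec x φ.1) = N * empGaussianComplexity Φ (x ∘ ρ) := by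
  have hbd : ∀ φ : Φ, ‖featureVec (x ∘ ρ) φ.1‖ ≤ √(Fintype.card (Fin N)) * DX :=
    fun φ => norm_featureVec_le _ hDX (hΦ _ φ.2)
  have h1 : empGaussianComplexity Φ (x ∘ ρ) =
      (1 / (N : ℝ)) * gaussWidth (fun φ : Φ => featureVec (x ∘ ρ) φ.1) := by
    rw [empGaussianComplexity, gaussWidth, ← integral_const_mul]
    refine integral_congr_ae (.of_forall fun g => ?_)
    simp only [supportFun]
    rw [Real.mul_iSup_of_nonneg (by positivity)]
    simp [featureVec, Fintype.sum_prod_type]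
  have he : Function.Injective fun q : Fin N × Fin p => (ρ q.1, q.2) :=
    fun a b h => by simpa [Prod.ext_iff] using h
  have hmp := measurePreserving_pi_comp (fun _ : J × Fin p => gaussianReal 0 1) he
  have h2 : gaussWidth (fun φ : Φ => featureVec (x ∘ ρ) φ.1) =
      gaussWidth (fun φ : Φ => featureVec x φ.1) := by
    rw [gaussWidth, gaussPi, ← hmp.map_eq, integral_map hmp.measurable.aemeasurable
      (measurable_supportFun hbd).aestronglyMeasurable]
    refine integral_congr_ae (.of_forall fun g => ?_)
    simp only [supportFun]
    congr 1
    funext φ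
    exact (ρ.prodCongr (Equiv.refl (Fin p))).sum_comp
      (fun q => g q * featureVec x φ.1 q)
  rw [h1, h2]
  field_simp

theorem empGaussianComplexity_linearClass {p n : ℕ} (W : Set (EuclideanSpace ℝ (Fin p)))
    (Z : Fin n → EuclideanSpace ℝ (Fin p)) {R : ℝ} (hR : ∀ w ∈ W, ‖scoreVec Z w‖ ≤ R) :
    empGaussianComplexity (linearClass W) Z =
      (1 / (n : ℝ)) * gaussWidth (fun w : W => scoreVec Z w.1) := by
  have he : Function.Injective (Prod.fst : Fin n × Fin 1 → Fin n) :=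
    fun a b h => Prod.ext h (Subsingleton.elim _ _)
  have hmp := measurePreserving_pi_comp (fun _ : Fin n => gaussianReal 0 1) he
  set v : W → EuclideanSpace ℝ (Fin n × Fin 1) :=
    fun w => WithLp.toLp 2 fun q => inner ℝ w.1 (Z q.1) with hv
  have hvR : ∀ w, ‖v w‖ ≤ R := fun w => by
    refine le_trans (le_of_eq ?_) (hR w.1 w.2)
    simp [EuclideanSpace.norm_eq, hv, scoreVec, Fintype.sum_prod_type]
  have h1 : empGaussianComplexity (linearClass W) Z = (1 / (n : ℝ)) * gaussWidth v := by
    rw [empGaussianComplexity, gaussWidth, ← integral_const_mul]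
    refine integral_congr_ae (.of_forall fun g => ?_)
    simp only [supportFun]
    rw [Real.mul_iSup_of_nonneg (by positivity), linearClass,
      ← Set.imageFactorization_surjective.iSup_comp]
    simp [Fintype.sum_prod_type, hv, Set.imageFactorization]
  rw [h1]
  congr 1
  rw [gaussWidth, gaussPi, ← hmp.map_eq, integral_map hmp.measurable.aemeasurable
      (measurable_supportFun hvR).aestronglyMeasurable]
  refine integral_congr_ae (.of_forall fun g => ?_)
  simp [supportFun, hv, scoreVec, Fintype.sum_prod_type]

/-! ### Widths and nets for the score vectors of all tasks. -/

section Complexity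

variable {α : Type*} {T n p : ℕ} {W : Set (EuclideanSpace ℝ (Fin p))}
  {Φ : Set (α → EuclideanSpace ℝ (Fin p))} {Wb Db : ℝ}

theorem norm_scoreVec_le (hWb : 0 ≤ Wb) (hDb : 0 ≤ Db) {w : EuclideanSpace ℝ (Fin p)}
    (hw : ‖w‖ ≤ Wb) {z : Fin n → EuclideanSpace ℝ (Fin p)} (hz : ∀ i, ‖z i‖ ≤ Db) :
    ‖scoreVec z w‖ ≤ √n * (Wb * Db) := by
  simpa using norm_le_sqrt_card_mul (x := scoreVec z w) (mul_nonneg hWb hDb)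
    fun i => abs_inner_le_of_norm_le hw (hz i)

theorem norm_taskScoreVec_le (hWb : 0 ≤ Wb) (hDb : 0 ≤ Db)
    {φ : α → EuclideanSpace ℝ (Fin p)} (hφ : ∀ x, ‖φ x‖ ≤ Db)
    {w : Fin T → EuclideanSpace ℝ (Fin p)} (hw : ∀ t, ‖w t‖ ≤ Wb) (x : Fin T × Fin n → α) :
    ‖taskScoreVec x φ w‖ ≤ √(Fintype.card (Fin T × Fin n)) * (Wb * Db) :=
  norm_le_sqrt_card_mul (x := taskScoreVec x φ w) (mul_nonneg hWb hDb)
    fun j => abs_inner_le_of_norm_le (hw j.1) (hφ _)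

theorem norm_taskScoreVec_sub_le (hWb : 0 ≤ Wb) (φ φ' : α → EuclideanSpace ℝ (Fin p))
    {w : Fin T → EuclideanSpace ℝ (Fin p)} (hw : ∀ t, ‖w t‖ ≤ Wb) (x : Fin T × Fin n → α) :
    ‖taskScoreVec x φ w - taskScoreVec x φ' w‖ ≤ Wb * ‖featureVec x φ - featureVec x φ'‖ := by
  refine le_of_sq_le_sq ?_ (by positivity)
  rw [mul_pow, norm_featureVec_sub_sq, EuclideanSpace.norm_sq_eq, Finset.mul_sum]
  refine Finset.sum_le_sum fun j _ => ?_
  rw [← mul_pow]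
  simp only [taskScoreVec, PiLp.sub_apply, ← inner_sub_right, Real.norm_eq_abs]
  gcongr
  exact abs_inner_le_of_norm_le (hw _) le_rfl

theorem empGaussianComplexity_le_worst (hWne : W.Nonempty) (hWb : 0 ≤ Wb) (hDb : 0 ≤ Db)
    (hW : ∀ w ∈ W, ‖w‖ ≤ Wb) (hΦ : ∀ φ ∈ Φ, ∀ x, ‖φ x‖ ≤ Db) {φ : α → EuclideanSpace ℝ (Fin p)}
    (hφ : φ ∈ Φ) (x : Fin n → α) :
    empGaussianComplexity (linearClass W) (fun i => φ (x i)) ≤ worstGaussianComplexity n W Φ := by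
  have := hWne.to_subtype
  refine le_ciSup (f := fun Z : Φ × (Fin n → α) =>
    empGaussianComplexity (linearClass W) (fun i => Z.1.1 (Z.2 i))) ?_ (⟨φ, hφ⟩, x)
  refine ⟨(1 / (n : ℝ)) * (√n * (Wb * Db) * ∫ g, ∑ i, |g i| ∂gaussPi (Fin n)), ?_⟩
  rintro _ ⟨⟨⟨φ, hφ⟩, x⟩, rfl⟩
  have hR : ∀ w ∈ W, ‖scoreVec (fun i => φ (x i)) w‖ ≤ √n * (Wb * Db) :=
    fun w hw => norm_scoreVec_le hWb hDb (hW w hw) fun i => hΦ φ hφ _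
  simp only
  rw [empGaussianComplexity_linearClass W _ hR]
  gcongr
  exact gaussWidth_le fun w : W => hR w.1 w.2

/-- For fixed features the predictors of different tasks are chosen independently, so the supremum
is bounded by a sum over tasks; each block is one instance of the worst-case complexity. -/
theorem gaussWidth_taskScoreVec_le (hn : 0 < n) (hWne : W.Nonempty) (hWb : 0 ≤ Wb) (hDb : 0 ≤ Db)
    (hW : ∀ w ∈ W, ‖w‖ ≤ Wb) (hΦ : ∀ φ ∈ Φ, ∀ x, ‖φ x‖ ≤ Db) {φ : α → EuclideanSpace ℝ (Fin p)}
    (hφ : φ ∈ Φ) (x : Fin T × Fin n → α) :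
    gaussWidth (fun w : Fin T → W => taskScoreVec x φ fun t => (w t).1) ≤
      (n * T : ℝ) * worstGaussianComplexity n W Φ := by
  have := hWne.to_subtype
  have hR : ∀ (t : Fin T) (w : W), ‖scoreVec (fun i => φ (x (t, i))) w.1‖ ≤ √n * (Wb * Db) :=
    fun t w => norm_scoreVec_le hWb hDb (hW w.1 w.2) fun i => hΦ φ hφ _
  have hR' : ∀ w : Fin T → W, ‖taskScoreVec x φ fun t => (w t).1‖ ≤
      √(Fintype.card (Fin T × Fin n)) * (Wb * Db) :=
    fun w => norm_taskScoreVec_le hWb hDb (hΦ φ hφ) (fun t => hW _ (w t).2) x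
  have hmp : ∀ t : Fin T, MeasurePreserving (fun (g : Fin T × Fin n → ℝ) i => g (t, i))
      (gaussPi (Fin T × Fin n)) (gaussPi (Fin n)) := fun t =>
    measurePreserving_pi_comp (fun _ : Fin T × Fin n => gaussianReal 0 1)
      (Prod.mk_right_injective t)
  have hint : ∀ t : Fin T, Integrable (fun g : Fin T × Fin n → ℝ =>
      supportFun (fun w : W => scoreVec (fun i => φ (x (t, i))) w.1) fun i => g (t, i))
      (gaussPi (Fin T × Fin n)) := fun t =>
    (hmp t).integrable_comp_of_integrable (integrable_supportFun (hR t))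
  calc gaussWidth (fun w : Fin T → W => taskScoreVec x φ fun t => (w t).1)
      ≤ ∫ g, ∑ t, supportFun (fun w : W => scoreVec (fun i => φ (x (t, i))) w.1)
          (fun i => g (t, i)) ∂gaussPi (Fin T × Fin n) := by
        refine integral_mono (integrable_supportFun hR') (integrable_finsetSum _ fun t _ => hint t)
          fun g => ciSup_le fun w => ?_
        rw [Fintype.sum_prod_type]
        exact Finset.sum_le_sum fun t _ => le_supportFun (hR t) (fun i => g (t, i)) (w t)
    _ = ∑ t, gaussWidth (fun w : W => scoreVec (fun i => φ (x (t, i))) w.1) := by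
        rw [integral_finsetSum _ fun t _ => hint t]
        refine Finset.sum_congr rfl fun t _ => ?_
        rw [gaussWidth, ← (hmp t).map_eq, integral_map (hmp t).measurable.aemeasurable
          (measurable_supportFun (hR t)).aestronglyMeasurable]
    _ ≤ ∑ _t : Fin T, n * worstGaussianComplexity n W Φ := by
        refine Finset.sum_le_sum fun t _ => ?_
        have h1 := empGaussianComplexity_le_worst hWne hWb hDb hW hΦ hφ fun i => x (t, i)
        rw [empGaussianComplexity_linearClass W _ fun w hw => hR t ⟨w, hw⟩] at h1
        rw [one_div, inv_mul_le_iff₀ (by positivity)] at h1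
        exact h1
    _ = _ := by simp; ring

/-- Log-cardinalities of the feature net and of the predictor nets add up. Radii add up too, since
changing the features moves the scores by at most `Wb` times the change. -/
theorem exists_net_taskScoreVec (hWne : W.Nonempty) (hΦne : Φ.Nonempty) (hT : 0 < T) (hn : 0 < n)
    (hWb : 0 < Wb) (hDb : 0 < Db)
    (hW : ∀ w ∈ W, ‖w‖ ≤ Wb) (hΦ : ∀ φ ∈ Φ, ∀ x, ‖φ x‖ ≤ Db) (x : Fin T × Fin n → α)
    {wA wB : ℝ} (hwA : 0 < wA) (hwB : 0 < wB)
    (hA : gaussWidth (fun φ : Φ => featureVec x φ.1) ≤ wA)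
    (hB : ∀ φ ∈ Φ, gaussWidth (fun w : Fin T → W => taskScoreVec x φ fun t => (w t).1) ≤ wB)
    (j : ℕ) :
    ∃ F : Finset (EuclideanSpace ℝ (Fin T × Fin n)),
      (F.card : ℝ) ≤ Real.exp ((23 * (Wb * wA + wB) /
        (√(Fintype.card (Fin T × Fin n)) * (Wb * Db))) ^ 2 * 4 ^ j) ∧
      ∀ w : Fin T → W, ∀ φ ∈ Φ, ∃ f ∈ F, ‖taskScoreVec x φ (fun t => (w t).1) - f‖ ≤
        4 * √(Fintype.card (Fin T × Fin n)) * (Wb * Db) / 2 ^ j := by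
  classical
  have := hWne.to_subtype
  have := hΦne.to_subtype
  set s := √(Fintype.card (Fin T × Fin n)) with hs
  have hs0 : 0 < s := Real.sqrt_pos.2 (by simp; positivity)
  obtain ⟨FA, hFA, hFA'⟩ := exists_dyadic_net
    (fun φ : Φ => norm_featureVec_le x hDb.le (hΦ φ.1 φ.2)) (by positivity) hwA hA j
  choose FB hFB hFB' using fun φ : Φ => exists_dyadic_net
    (fun w : Fin T → W => norm_taskScoreVec_le hWb.le hDb.le (hΦ φ.1 φ.2) (fun t => hW _ (w t).2) x)
    (by positivity) hwB (hB φ.1 φ.2) j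
  refine ⟨FA.biUnion fun φ => (FB φ).image fun w => taskScoreVec x φ.1 fun t => (w t).1, ?_, ?_⟩
  · refine (Nat.cast_le.2 Finset.card_biUnion_le).trans ?_
    push_cast
    refine (Finset.sum_le_sum fun φ _ => (Nat.cast_le.2 Finset.card_image_le).trans (hFB φ)).trans ?_
    rw [Finset.sum_const, nsmul_eq_mul]
    refine (mul_le_mul_of_nonneg_right hFA (Real.exp_pos _).le).trans ?_
    rw [← Real.exp_add, Real.exp_le_exp, ← add_mul]
    gcongr
    have e : 512 * wA ^ 2 / (s * Db) ^ 2 + 512 * wB ^ 2 / (s * (Wb * Db)) ^ 2 =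
        512 * ((Wb * wA) ^ 2 + wB ^ 2) / (s * (Wb * Db)) ^ 2 := by field_simp
    rw [e, div_pow]
    gcongr
    -- Here `512 ≤ 23 ^ 2`, and the cross term is positive.
    have : 0 < Wb * wA * wB := by positivity
    nlinarith [sq_nonneg (Wb * wA), sq_nonneg wB]
  · intro w φ hφ
    obtain ⟨φ', hφ', h1⟩ := hFA' ⟨φ, hφ⟩
    obtain ⟨w', hw', h2⟩ := hFB' φ' w
    refine ⟨taskScoreVec x φ'.1 fun t => (w' t).1,
      Finset.mem_biUnion.2 ⟨φ', hφ', Finset.mem_image_of_mem _ hw'⟩, ?_⟩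
    have h3 := norm_taskScoreVec_sub_le hWb.le φ φ'.1 (fun t => hW _ (w t).2) x
    have h4 := mul_le_mul_of_nonneg_left h1 hWb.le
    refine (norm_sub_le_norm_sub_add_norm_sub _
      (taskScoreVec x φ'.1 fun t => (w t).1) _).trans ?_
    have e : 4 * s * (Wb * Db) / 2 ^ j =
        Wb * (2 * (s * Db) / 2 ^ j) + 2 * (s * (Wb * Db)) / 2 ^ j := by ring
    rw [e]
    exact add_le_add (h3.trans h4) h2

end Complexity

/-- For `N ≥ 2` rounding up costs at most a factor `2`, and `2 / log 2 < 3`; at `N = 1` both sides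
vanish. -/
theorem clog_two_le_log (N : ℕ) : (Nat.clog 2 N : ℝ) ≤ 3 * Real.log N := by
  rcases Nat.lt_or_ge N 2 with hN | hN
  · rw [Nat.clog_of_right_le_one (by omega)]
    have : 0 ≤ Real.log N := Real.log_natCast_nonneg N
    simpa using this
  · have h1 := Nat.pow_pred_clog_lt_self (b := 2) (by norm_num) (x := N) (by omega)
    have hc : 0 < Nat.clog 2 N := Nat.clog_pos (by norm_num) hN
    have h2 : ((2 : ℝ) ^ (Nat.clog 2 N).pred) ≤ N := by exact_mod_cast h1.le
    have h3 := Real.log_le_log (by positivity) h2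
    rw [Real.log_pow] at h3
    have h4 : Real.log 2 ≤ Real.log N := Real.log_le_log (by norm_num) (by exact_mod_cast hN)
    have h5 : ((Nat.clog 2 N).pred : ℝ) = Nat.clog 2 N - 1 := by
      rw [Nat.pred_eq_sub_one, Nat.cast_sub hc]; simp
    rw [h5] at h3
    have h6 := Real.log_two_gt_d9
    have h7 : (0 : ℝ) ≤ Nat.clog 2 N := by positivity
    nlinarith

/-- The chain rule for the composition of the linear class with the features, at fixed inputs. -/
theorem signAvg_loss_le {α κ : Type*} [Nonempty κ] {T n p : ℕ} {W : Set (EuclideanSpace ℝ (Fin p))}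
    {Φ : Set (α → EuclideanSpace ℝ (Fin p))} {Wb Db L : ℝ}
    (hT : 0 < T) (hn : 0 < n) (hWb : 0 ≤ Wb) (hDb : 0 ≤ Db) (hL : 0 ≤ L)
    (hW : ∀ w ∈ W, ‖w‖ ≤ Wb) (hΦ : ∀ φ ∈ Φ, ∀ x, ‖φ x‖ ≤ Db)
    (ρ : Fin (n * T) ≃ Fin T × Fin n) (x : Fin T × Fin n → α)
    (w : κ → Fin T → EuclideanSpace ℝ (Fin p)) (hw : ∀ k t, w k t ∈ W)
    (φ : κ → α → EuclideanSpace ℝ (Fin p)) (hφ : ∀ k, φ k ∈ Φ)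
    (ψ : Fin T × Fin n → ℝ → ℝ) (hψ : ∀ i u u', |ψ i u - ψ i u'| ≤ L * |u - u'|) :
    signAvg (fun σ => ⨆ k, ∑ j, sgn (σ j) * ψ j (inner ℝ (w k j.1) (φ k (x j)))) ≤
      (n * T : ℝ) * (L * (4 * (Wb * Db / ((n : ℝ) * T) ^ 2) + 2760 * (Real.log ((n : ℝ) * T) *
        (Wb * empGaussianComplexity Φ (x ∘ ρ) + worstGaussianComplexity n W Φ)))) := by
  obtain ⟨k₀⟩ := ‹Nonempty κ›
  have : Nonempty κ := ⟨k₀⟩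
  have hΦne : Φ.Nonempty := ⟨_, hφ k₀⟩
  have hWne : W.Nonempty := ⟨_, hw k₀ ⟨0, hT⟩⟩
  have := hΦne.to_subtype
  have := hWne.to_subtype
  have hN : 0 < n * T := by positivity
  have hNR : (0 : ℝ) < n * T := by exact_mod_cast hN
  set G := empGaussianComplexity Φ (x ∘ ρ) with hG
  set Gw := worstGaussianComplexity n W Φ with hGw
  have hwidthA := gaussWidth_featureVec hN ρ x Φ hDb hΦ
  have hA0 : 0 ≤ gaussWidth (fun φ : Φ => featureVec x φ.1) :=
    gaussWidth_nonneg fun φ : Φ => norm_featureVec_le x hDb (hΦ φ.1 φ.2)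
  have hB : ∀ φ ∈ Φ, _ := fun φ hφ => gaussWidth_taskScoreVec_le hn hWne hWb hDb hW hΦ hφ x
  have hB0 : 0 ≤ (n * T : ℝ) * Gw := (gaussWidth_nonneg fun w : Fin T → W =>
    norm_taskScoreVec_le hWb hDb (hΦ _ (hφ k₀)) (fun t => hW _ (w t).2) x).trans (hB _ (hφ k₀))
  rw [hwidthA] at hA0
  push_cast at hA0 hwidthA
  -- With this depth `2 ^ J ≥ (nT)²`, while `J ≤ 6 log (nT)`.
  set J : ℕ := 2 * Nat.clog 2 (n * T) with hJ
  have hcard : (Fintype.card (Fin T × Fin n) : ℝ) = n * T := by simp [mul_comm]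
  -- The nets need strictly positive widths and radii; all four quantities are enlarged by `η`,
  -- which then tends to `0`.
  have key : ∀ η : ℝ, 0 < η →
      signAvg (fun σ => ⨆ k, ∑ j, sgn (σ j) * ψ j (inner ℝ (w k j.1) (φ k (x j)))) ≤
      L * (460 * ((Wb + η) * (n * T * G + η) + (n * T * Gw + η)) * J +
        4 * (n * T) * ((Wb + η) * (Db + η)) / 2 ^ J) := by
    intro η hη
    have hnet := exists_net_taskScoreVec (Wb := Wb + η) (Db := Db + η) hWne hΦne hT hn
      (by positivity) (by positivity) (fun w hw => (hW w hw).trans (by linarith))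
      (fun φ hφ x => (hΦ φ hφ x).trans (by linarith)) x (wA := n * T * G + η)
      (wB := n * T * Gw + η) (by positivity) (by positivity) (by rw [hwidthA]; linarith)
      (fun φ hφ => (hB φ hφ).trans (by linarith))
    set s := √(Fintype.card (Fin T × Fin n)) with hs
    have hss : s * s = n * T := by rw [hs, Real.mul_self_sqrt (by positivity), hcard]
    have hs0 : 0 < s := Real.sqrt_pos.2 (by rw [hcard]; exact hNR)
    have hch := signAvg_iSup_le (fun k => taskScoreVec x (φ k) (w k)) ψ hL
      (a := 23 * ((Wb + η) * (n * T * G + η) + (n * T * Gw + η)) / (s * ((Wb + η) * (Db + η))))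
      (r := 4 * s * ((Wb + η) * (Db + η))) (by positivity) (by positivity) hψ
      (fun j => by
        obtain ⟨F, hF, hF'⟩ := hnet j
        exact ⟨F, hF, fun k => hF' (fun t => ⟨w k t, hw k t⟩) (φ k) (hφ k)⟩)
      ⟨0, fun k => by
        rw [sub_zero]
        refine (norm_taskScoreVec_le (Wb := Wb + η) (Db := Db + η) (by positivity) (by positivity)
          (fun x => (hΦ _ (hφ k) x).trans (by linarith))
          (fun t => (hW _ (hw k t)).trans (by linarith)) x).trans ?_
        rw [mul_assoc]
        exact le_mul_of_one_le_left (by positivity) (by norm_num)⟩ J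
    -- The constant is `460 = 5 * 23 * 4`, and the scale `s * (Wb + η) * (Db + η)` cancels in `a *
    -- r`.
    refine hch.trans_eq ?_
    congr 2
    · field_simp; ring
    · rw [← hs]
      calc s * (4 * s * ((Wb + η) * (Db + η))) / 2 ^ J
          = 4 * (s * s) * ((Wb + η) * (Db + η)) / 2 ^ J := by ring
        _ = _ := by rw [hss]
  have hlim : signAvg (fun σ => ⨆ k, ∑ j, sgn (σ j) * ψ j (inner ℝ (w k j.1) (φ k (x j)))) ≤
      L * (460 * ((Wb + 0) * (n * T * G + 0) + (n * T * Gw + 0)) * J +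
        4 * (n * T) * ((Wb + 0) * (Db + 0)) / 2 ^ J) := by
    refine ge_of_tendsto (x := 𝓝[>] (0 : ℝ)) (f := fun η => L * (460 * ((Wb + η) *
      (n * T * G + η) + (n * T * Gw + η)) * J + 4 * (n * T) * ((Wb + η) * (Db + η)) / 2 ^ J)) ?_
      (eventually_mem_nhdsWithin.mono key)
    refine Tendsto.mono_left (Continuous.tendsto ?_ 0) nhdsWithin_le_nhds
    fun_prop
  simp only [add_zero] at hlim
  refine hlim.trans ?_
  rw [mul_left_comm ((n : ℝ) * T) L]
  refine mul_le_mul_of_nonneg_left ?_ hL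
  have h1 : ((n : ℝ) * T) ^ 2 ≤ 2 ^ J := by
    have := Nat.le_pow_clog (b := 2) (by norm_num) (n * T)
    have h2 : ((n * T : ℕ) : ℝ) ≤ 2 ^ Nat.clog 2 (n * T) := by exact_mod_cast this
    push_cast at h2
    rw [hJ, mul_comm 2 (Nat.clog _ _), pow_mul]
    gcongr
  have h2 : (J : ℝ) ≤ 6 * Real.log ((n : ℝ) * T) := by
    have := clog_two_le_log (n * T)
    push_cast at this
    rw [hJ]; push_cast; linarith
  have h3 : 4 * ((n : ℝ) * T) * (Wb * Db) / 2 ^ J ≤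
      4 * (n * T) * (Wb * Db) / ((n : ℝ) * T) ^ 2 := by gcongr
  have h4 : 0 ≤ Wb * (n * T * G) + n * T * Gw := by positivity
  have h5 := mul_le_mul_of_nonneg_left h2 (mul_nonneg (by norm_num : (0 : ℝ) ≤ 460) h4)
  refine (add_le_add h5 h3).trans_eq ?_
  ring

/-! ### The bounded differences inequality -/

theorem abs_ciSup_le_of_forall {κ : Type*} [Nonempty κ] {a : κ → ℝ} {M : ℝ}
    (h : ∀ k, |a k| ≤ M) : |⨆ k, a k| ≤ M := by
  obtain ⟨k⟩ := ‹Nonempty κ›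
  have : Nonempty κ := ⟨k⟩
  have hb : BddAbove (Set.range a) := ⟨M, by rintro _ ⟨k, rfl⟩; exact (abs_le.1 (h k)).2⟩
  exact abs_le.2 ⟨(abs_le.1 (h k)).1.trans (le_ciSup hb k), ciSup_le fun k => (abs_le.1 (h k)).2⟩

theorem bddAbove_range_of_abs_le {κ : Type*} {a : κ → ℝ} {M : ℝ}
    (h : ∀ k, |a k| ≤ M) : BddAbove (Set.range a) :=
  ⟨M, by rintro _ ⟨k, rfl⟩; exact (abs_le.1 (h k)).2⟩

theorem integrable_of_abs_le {Ω : Type*} [MeasurableSpace Ω] {μ : Measure Ω} [IsFiniteMeasure μ]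
    {f : Ω → ℝ} (hf : Measurable f) {M : ℝ} (h : ∀ x, |f x| ≤ M) : Integrable f μ :=
  Integrable.of_bound hf.aestronglyMeasurable M (.of_forall h)

theorem abs_integral_le_of_abs_le {Ω : Type*} [MeasurableSpace Ω] {μ : Measure Ω}
    [IsProbabilityMeasure μ] {f : Ω → ℝ} {M : ℝ} (h : ∀ x, |f x| ≤ M) : |∫ x, f x ∂μ| ≤ M := by
  have := norm_integral_le_of_norm_le_const (μ := μ) (f := f) (.of_forall h)
  simpa using this

/-- Hoeffding's lemma, with the interval starting at the infimum of `f`. -/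
theorem integral_exp_mul_le_of_range_le {Ω : Type*} [MeasurableSpace Ω] {μ : Measure Ω}
    [IsProbabilityMeasure μ] {f : Ω → ℝ} (hf : Measurable f) {M c : ℝ} (hM : ∀ x, |f x| ≤ M)
    (hc : ∀ x y, f x - f y ≤ c) (s : ℝ) :
    ∫ x, Real.exp (s * f x) ∂μ ≤ Real.exp (s * ∫ x, f x ∂μ + s ^ 2 * c ^ 2 / 8) := by
  have : Nonempty Ω := nonempty_of_isProbabilityMeasure μ
  have hb : BddBelow (Set.range f) := ⟨-M, by rintro _ ⟨k, rfl⟩; exact (abs_le.1 (hM k)).1⟩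
  have hmem : ∀ x, f x ∈ Set.Icc (⨅ y, f y) ((⨅ y, f y) + c) := fun x =>
    ⟨ciInf_le hb x, by
      have : f x - c ≤ ⨅ y, f y := le_ciInf fun y => by linarith [hc x y]
      linarith⟩
  have h := (hasSubgaussianMGF_of_mem_Icc (μ := μ) hf.aemeasurable (.of_forall hmem)).mgf_le s
  have e : ∫ x, Real.exp (s * f x) ∂μ =
      Real.exp (s * ∫ x, f x ∂μ) * mgf (fun x => f x - ∫ y, f y ∂μ) μ s := by
    rw [mgf, ← integral_const_mul]
    refine integral_congr_ae (.of_forall fun x => ?_)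
    simp only
    rw [← Real.exp_add]; congr 1; ring
  rw [e, Real.exp_add]
  refine mul_le_mul_of_nonneg_left (h.trans_eq ?_) (Real.exp_pos _).le
  congr 1
  push_cast
  rw [Real.norm_eq_abs, div_pow, sq_abs]
  ring

/-- Induction on the number of variables: Hoeffding's lemma in the first one, with the others
frozen, leaves its partial integral `g`, which inherits the bounded differences. -/
theorem integral_exp_mul_le_of_bounded_differences {Ω : Type*} [MeasurableSpace Ω] (n : ℕ)
    (μ : Fin n → Measure Ω) [∀ i, IsProbabilityMeasure (μ i)] {f : (Fin n → Ω) → ℝ}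
    (hf : Measurable f) {M c : ℝ} (hM : ∀ x, |f x| ≤ M)
    (hc : ∀ x i y, f (Function.update x i y) - f x ≤ c) (s : ℝ) :
    ∫ x, Real.exp (s * f x) ∂Measure.pi μ ≤
      Real.exp (s * ∫ x, f x ∂Measure.pi μ + n * (s ^ 2 * c ^ 2 / 8)) := by
  induction n with
  | zero =>
    have h0 : f = fun _ => f isEmptyElim := funext fun x => congrArg f (Subsingleton.elim _ _)
    rw [h0]
    simp
  | succ n ih =>
    set P := Measure.pi fun j : Fin n => μ (Fin.succAbove 0 j) with hP
    have hmp := (measurePreserving_piFinSuccAbove μ 0).symm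
    set F : Ω → (Fin n → Ω) → ℝ := fun x₀ x => f (Fin.cons x₀ x) with hF
    have hcons : ∀ (x₀ : Ω) (x : Fin n → Ω),
        (MeasurableEquiv.piFinSuccAbove (fun _ : Fin (n + 1) => Ω) 0).symm (x₀, x) =
          Fin.cons x₀ x := by
      intro x₀ x
      simp [MeasurableEquiv.piFinSuccAbove]
      rfl
    have hFm : Measurable (Function.uncurry F) := by
      have : Function.uncurry F = f ∘
          (MeasurableEquiv.piFinSuccAbove (fun _ : Fin (n + 1) => Ω) 0).symm := by
        funext ⟨x₀, x⟩
        rw [Function.comp_apply, hcons]; rfl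
      rw [this]
      exact hf.comp (MeasurableEquiv.measurable _)
    have hint : ∀ G : ℝ → ℝ, Measurable G → (∃ C, ∀ u, |u| ≤ M → |G u| ≤ C) →
        ∫ x, G (f x) ∂Measure.pi μ = ∫ x, ∫ x₀, G (F x₀ x) ∂μ 0 ∂P := by
      intro G hG hGb
      obtain ⟨C, hC⟩ := hGb
      rw [← hmp.integral_comp', integral_prod_symm]
      · simp only [hcons]; rfl
      · exact integrable_of_abs_le (hG.comp (hf.comp (MeasurableEquiv.measurable _)))
          fun z => hC _ (hM _)
    have hFs : ∀ x, Measurable fun x₀ => F x₀ x := fun x =>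
      hFm.comp (measurable_id.prodMk measurable_const)
    set g : (Fin n → Ω) → ℝ := fun x => ∫ x₀, F x₀ x ∂μ 0 with hg
    have hgm : Measurable g :=
      (hFm.comp measurable_swap).stronglyMeasurable.integral_prod_right'.measurable
    have hFi : ∀ x, Integrable (fun x₀ => F x₀ x) (μ 0) := fun x =>
      integrable_of_abs_le (hFs x) fun x₀ => hM _
    have hgM : ∀ x, |g x| ≤ M := fun x => abs_integral_le_of_abs_le fun x₀ => hM _
    have hgc : ∀ x i y, g (Function.update x i y) - g x ≤ c := by
      intro x i y
      rw [hg]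
      simp only
      rw [← integral_sub (hFi _) (hFi _)]
      refine (integral_mono ((hFi _).sub (hFi _)) (integrable_const c) fun x₀ => ?_).trans_eq
        (by simp)
      simp only [Pi.sub_apply, hF, Fin.cons_update]
      exact hc _ _ _
    have hih := ih (fun j => μ (Fin.succAbove 0 j)) hgm hgM hgc
    rw [← hP] at hih
    have hfe : ∫ x, f x ∂Measure.pi μ = ∫ x, g x ∂P := hint id measurable_id ⟨M, fun u h => h⟩
    have hexpM : ∀ u : ℝ, |u| ≤ M → |Real.exp (s * u)| ≤ Real.exp (|s| * M) := by
      intro u hu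
      rw [abs_of_pos (Real.exp_pos _), Real.exp_le_exp]
      refine (le_abs_self _).trans ?_
      rw [abs_mul]; gcongr
    rw [hint (fun u => Real.exp (s * u)) (by fun_prop) ⟨_, hexpM⟩, hfe]
    have hstep : ∀ x, ∫ x₀, Real.exp (s * F x₀ x) ∂μ 0 ≤
        Real.exp (s ^ 2 * c ^ 2 / 8) * Real.exp (s * g x) := by
      intro x
      rw [← Real.exp_add, add_comm (s ^ 2 * c ^ 2 / 8)]
      refine integral_exp_mul_le_of_range_le (hFs x) (fun x₀ => hM _) (fun x₀ y₀ => ?_) s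
      have := hc (Fin.cons y₀ x) 0 x₀
      rwa [Fin.update_cons_zero] at this
    have hEm : Measurable fun x => ∫ x₀, Real.exp (s * F x₀ x) ∂μ 0 := by
      have : Measurable (Function.uncurry fun x x₀ => Real.exp (s * F x₀ x)) :=
        Real.measurable_exp.comp ((hFm.comp measurable_swap).const_mul s)
      exact this.stronglyMeasurable.integral_prod_right.measurable
    have hE1 : Integrable (fun x => ∫ x₀, Real.exp (s * F x₀ x) ∂μ 0) P :=
      integrable_of_abs_le hEm fun x =>
        abs_integral_le_of_abs_le fun x₀ => hexpM _ (hM _)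
    have hE2 : Integrable (fun x => Real.exp (s * g x)) P :=
      integrable_of_abs_le (by fun_prop) fun x => hexpM _ (hgM x)
    refine (integral_mono hE1 (hE2.const_mul _) hstep).trans ?_
    rw [integral_const_mul]
    refine (mul_le_mul_of_nonneg_left (hih) (Real.exp_pos _).le).trans_eq ?_
    rw [← Real.exp_add]
    congr 1
    push_cast; ring

/-- **McDiarmid's inequality** for a bounded measurable function of independent variables. -/
theorem measureReal_lt_le_of_bounded_differences {Ω J : Type*} [MeasurableSpace Ω] [Fintype J]
    [DecidableEq J] (μ : J → Measure Ω) [∀ i, IsProbabilityMeasure (μ i)] {f : (J → Ω) → ℝ}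
    (hf : Measurable f) {M c δ : ℝ} (hM : ∀ x, |f x| ≤ M) (hc0 : 0 ≤ c)
    (hc : ∀ x i y, f (Function.update x i y) - f x ≤ c) (hδ : 0 < δ) (hδ1 : δ ≤ 1) :
    (Measure.pi μ).real {x | ∫ x, f x ∂Measure.pi μ +
      c * √(Fintype.card J * Real.log (1 / δ) / 2) < f x} ≤ δ := by
  set P := Measure.pi μ with hP
  have hmgf : ∀ s, ∫ x, Real.exp (s * f x) ∂P ≤
      Real.exp (s * ∫ x, f x ∂P + Fintype.card J * (s ^ 2 * c ^ 2 / 8)) := by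
    intro s
    set e := (Fintype.equivFin J).symm
    have hmp := measurePreserving_pi_comp (fun i => μ (e i)) e.symm.injective
    simp only [Equiv.apply_symm_apply] at hmp
    rw [← hP] at hmp
    have h := integral_exp_mul_le_of_bounded_differences _ (fun i => μ (e i))
      (f := fun g => f fun j => g (e.symm j)) (hf.comp hmp.measurable) (fun x => hM _)
      (fun x i y => by
        have := hc (fun j => x (e.symm j)) (e i) y
        have h2 : (fun j => Function.update x i y (e.symm j)) =
            Function.update (fun j => x (e.symm j)) (e i) y := by
          funext j
          simp only [Function.update_apply, Equiv.symm_apply_eq]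
        rwa [h2]) s
    rw [← hmp.map_eq, integral_map hmp.measurable.aemeasurable
      (by exact Measurable.aestronglyMeasurable (by fun_prop)),
      integral_map hmp.measurable.aemeasurable hf.aestronglyMeasurable]
    exact h
  set v : NNReal := ⟨Fintype.card J * (c ^ 2 / 4), by positivity⟩ with hv
  have hsub : HasSubgaussianMGF (fun x => f x - ∫ x, f x ∂P) v P := by
    refine ⟨fun s => ?_, fun s => ?_⟩
    · refine integrable_of_abs_le (by fun_prop) (M := Real.exp (|s| * (M + |∫ x, f x ∂P|)))
        fun x => ?_
      rw [abs_of_pos (Real.exp_pos _), Real.exp_le_exp]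
      refine (le_abs_self _).trans ?_
      rw [abs_mul]
      gcongr
      exact (abs_sub _ _).trans (by gcongr; exact hM x)
    · have e : mgf (fun x => f x - ∫ x, f x ∂P) P s =
          Real.exp (-(s * ∫ x, f x ∂P)) * ∫ x, Real.exp (s * f x) ∂P := by
        rw [mgf, ← integral_const_mul]
        refine integral_congr_ae (.of_forall fun x => ?_)
        simp only
        rw [← Real.exp_add]; congr 1; ring
      rw [e]
      refine (mul_le_mul_of_nonneg_left (hmgf s) (Real.exp_pos _).le).trans_eq ?_
      rw [← Real.exp_add, hv]
      congr 1
      change _ = Fintype.card J * (c ^ 2 / 4) * s ^ 2 / 2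
      ring
  have hlog : 0 ≤ Real.log (1 / δ) := Real.log_nonneg (by rw [le_div_iff₀ hδ]; linarith)
  set u := c * √(Fintype.card J * Real.log (1 / δ) / 2) with hu
  have hu0 : 0 ≤ u := by positivity
  -- For `v = 0` the tail bound would divide by zero; there `f` is almost surely equal to its mean.
  rcases (zero_le (a := v)).eq_or_lt with h0 | h0
  · rw [← h0] at hsub
    have hz := hsub.ae_eq_zero_of_hasSubgaussianMGF_zero
    have : P {x | ∫ x, f x ∂P + u < f x} = 0 := by
      refine measure_mono_null (fun x hx => ?_) (ae_iff.1 hz)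
      simp only [Set.mem_ofPred_eq, Pi.zero_apply] at hx ⊢
      intro h
      linarith
    rw [Measure.real, this]
    exact hδ.le
  · refine (measureReal_mono (fun x hx => ?_)).trans ((hsub.measure_ge_le hu0).trans_eq ?_)
    · simp only [Set.mem_ofPred_eq] at hx ⊢
      linarith
    · have hv0 : (0 : ℝ) < Fintype.card J * (c ^ 2 / 4) := h0
      have : -u ^ 2 / (2 * (v : ℝ)) = -Real.log (1 / δ) := by
        change -u ^ 2 / (2 * (Fintype.card J * (c ^ 2 / 4))) = _
        rw [hu, mul_pow, Real.sq_sqrt (by positivity), div_eq_iff (by positivity)]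
        ring
      rw [this, one_div, Real.log_inv, neg_neg, Real.exp_log hδ]

/-! ### Symmetrization -/

/-- A ghost sample replaces the expectations. Swapping a point with its ghost preserves the law, so
random signs can be inserted for free, and the supremum splits into two Rademacher averages. -/
theorem integral_iSup_sub_le_of_signAvg_le {J κ Ω : Type*} [MeasurableSpace Ω] [Fintype J]
    [DecidableEq J] [Countable κ] [Nonempty κ] (μ : J → Measure Ω)
    [∀ i, IsProbabilityMeasure (μ i)] {f : κ → J → Ω → ℝ} (hf : ∀ k j, Measurable (f k j)) {B : ℝ}
    (hB : ∀ k j z, |f k j z| ≤ B) {U : (J → Ω) → ℝ} (hU : Integrable U (Measure.pi μ))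
    (h : ∀ S : J → Ω, signAvg (fun σ => ⨆ k, ∑ j, sgn (σ j) * f k j (S j)) ≤ U S) :
    ∫ S, ⨆ k, ∑ j, (∫ z, f k j z ∂μ j - f k j (S j)) ∂Measure.pi μ ≤
      2 * ∫ S, U S ∂Measure.pi μ := by
  set P := Measure.pi μ with hP
  set Q := Measure.pi fun j => (μ j).prod (μ j) with hQ
  set N : ℝ := (Fintype.card J : ℝ) with hN
  have hsum : ∀ a : J → ℝ, ∀ M : ℝ, (∀ j, |a j| ≤ M) → |∑ j, a j| ≤ N * M := fun a M ha => by
    refine (Finset.abs_sum_le_sum_abs _ _).trans ((Finset.sum_le_sum fun j _ => ha j).trans_eq ?_)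
    simp [hN]
  have hdiff : ∀ k (σ : J → Bool) (z : J → Ω × Ω),
      |∑ j, sgn (σ j) * (f k j (z j).2 - f k j (z j).1)| ≤ N * (B + B) := fun k σ z =>
    hsum _ _ fun j => by
      rw [abs_mul, abs_sgn, one_mul]
      exact (abs_sub _ _).trans (add_le_add (hB _ _ _) (hB _ _ _))
  set H : (J → Bool) → (J → Ω × Ω) → ℝ :=
    fun σ z => ⨆ k, ∑ j, sgn (σ j) * (f k j (z j).2 - f k j (z j).1) with hH
  have hHm : ∀ σ, Measurable (H σ) := fun σ => Measurable.iSup fun k =>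
    Finset.measurable_sum _ fun j _ => Measurable.const_mul
      (((hf k j).comp (by fun_prop)).sub ((hf k j).comp (by fun_prop))) _
  have hHb : ∀ σ z, |H σ z| ≤ N * (B + B) := fun σ z =>
    abs_ciSup_le_of_forall fun k => hdiff k σ z
  have hHi : ∀ σ, Integrable (H σ) Q := fun σ => integrable_of_abs_le (hHm σ) (hHb σ)
  have hsub : ∀ k (S S' : J → Ω), |∑ j, (f k j (S' j) - f k j (S j))| ≤ N * (B + B) :=
    fun k S S' => hsum _ _ fun j => (abs_sub _ _).trans (add_le_add (hB _ _ _) (hB _ _ _))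
  set G : (J → Ω) → (J → Ω) → ℝ := fun S S' => ⨆ k, ∑ j, (f k j (S' j) - f k j (S j)) with hG
  have hGm : Measurable (Function.uncurry G) := Measurable.iSup fun k =>
    Finset.measurable_sum _ fun j _ =>
      (((hf k j).comp (by fun_prop)).sub ((hf k j).comp (by fun_prop)))
  have hGb : ∀ S S', |G S S'| ≤ N * (B + B) := fun S S' =>
    abs_ciSup_le_of_forall fun k => hsub k S S'
  have hfP : ∀ k j, Integrable (fun S : J → Ω => f k j (S j)) P := fun k j =>
    integrable_of_abs_le ((hf k j).comp (measurable_pi_apply j)) fun S => hB k j _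
  have hfc : ∀ k j (a : ℝ), Integrable (fun S : J → Ω => f k j (S j) - a) P := fun k j a =>
    (hfP k j).sub (integrable_const a)
  have hfint : ∀ k j, ∫ S : J → Ω, f k j (S j) ∂P = ∫ z, f k j z ∂μ j := fun k j => by
    rw [← (measurePreserving_eval μ j).map_eq, integral_map
      (measurable_pi_apply j).aemeasurable (hf k j).aestronglyMeasurable]
  have hGs : ∀ S, Integrable (G S) P := fun S =>
    integrable_of_abs_le (hGm.comp (measurable_const.prodMk measurable_id)) (hGb S)
  have hghost : ∀ S : J → Ω, (⨆ k, ∑ j, (∫ z, f k j z ∂μ j - f k j (S j))) ≤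
      ∫ S', G S S' ∂P := by
    intro S
    refine ciSup_le fun k => ?_
    have e : ∑ j, (∫ z, f k j z ∂μ j - f k j (S j)) =
        ∫ S' : J → Ω, ∑ j, (f k j (S' j) - f k j (S j)) ∂P := by
      rw [integral_finsetSum _ fun j _ => hfc k j _]
      refine Finset.sum_congr rfl fun j _ => ?_
      rw [integral_sub (hfP k j) (integrable_const _), hfint]
      simp
    rw [e]
    refine integral_mono (integrable_finsetSum _ fun j _ => hfc k j _)
      (hGs S) fun S' => ?_
    exact le_ciSup (bddAbove_range_of_abs_le fun k => hsub k S S') k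
  have hlm : Measurable fun S : J → Ω => ⨆ k, ∑ j, (∫ z, f k j z ∂μ j - f k j (S j)) :=
    Measurable.iSup fun k => Finset.measurable_sum _ fun j _ =>
      ((hf k j).comp (measurable_pi_apply j)).const_sub _
  have hlb : ∀ S : J → Ω, |⨆ k, ∑ j, (∫ z, f k j z ∂μ j - f k j (S j))| ≤ N * (B + B) :=
    fun S => abs_ciSup_le_of_forall fun k => hsum _ _ fun j => by
      exact (abs_sub _ _).trans (add_le_add (abs_integral_le_of_abs_le (hB k j)) (hB _ _ _))
  have hGi : Integrable (Function.uncurry G) (P.prod P) :=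
    integrable_of_abs_le hGm fun z => hGb _ _
  have h1 : ∫ S, ⨆ k, ∑ j, (∫ z, f k j z ∂μ j - f k j (S j)) ∂P ≤
      ∫ z, H (fun _ => true) z ∂Q := by
    refine (integral_mono (integrable_of_abs_le hlm hlb) hGi.integral_prod_left hghost).trans_eq ?_
    rw [← integral_prod _ hGi]
    have hmp := measurePreserving_arrowProdEquivProdArrow Ω Ω J μ μ
    rw [← hP, ← hQ] at hmp
    rw [← hmp.integral_comp']
    refine integral_congr_ae (.of_forall fun z => ?_)
    simp [hH, hG, sgn, Function.uncurry, MeasurableEquiv.arrowProdEquivProdArrow,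
      Equiv.arrowProdEquivProdArrow]
  have h2 : ∀ σ, ∫ z, H σ z ∂Q = ∫ z, H (fun _ => true) z ∂Q := by
    intro σ
    have hmp : MeasurePreserving
        (fun (z : J → Ω × Ω) j => (if σ j then id else Prod.swap : Ω × Ω → Ω × Ω) (z j)) Q Q :=
      measurePreserving_pi _ _ fun j => by
        by_cases hj : σ j
        · simp only [hj, if_true]; exact MeasurePreserving.id _
        · simp only [hj, Bool.false_eq_true, if_false]; exact Measure.measurePreserving_swap
    conv_rhs => rw [← hmp.map_eq, integral_map hmp.measurable.aemeasurable
      (hHm _).aestronglyMeasurable]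
    refine integral_congr_ae (.of_forall fun z => ?_)
    simp only [hH]
    congr 1
    funext k
    refine Finset.sum_congr rfl fun j _ => ?_
    cases hj : σ j <;> simp [sgn]
  have hfst : MeasurePreserving (fun (z : J → Ω × Ω) j => (z j).1) Q P :=
    measurePreserving_pi _ _ fun j => measurePreserving_fst
  have hsnd : MeasurePreserving (fun (z : J → Ω × Ω) j => (z j).2) Q P :=
    measurePreserving_pi _ _ fun j => measurePreserving_snd
  have hone : ∀ (σ : J → Bool) (S : J → Ω) k, |∑ j, sgn (σ j) * f k j (S j)| ≤ N * B :=
    fun σ S k => hsum _ _ fun j => by rw [abs_mul, abs_sgn, one_mul]; exact hB _ _ _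
  have h3 : ∀ z : J → Ω × Ω, signAvg (fun σ => H σ z) ≤
      U (fun j => (z j).2) + U (fun j => (z j).1) := by
    intro z
    refine le_trans ?_ (add_le_add (h fun j => (z j).2) (h fun j => (z j).1))
    -- The first sample enters with the opposite sign; flipping all signs does not change its
    -- average.
    rw [← signAvg_comp_not (fun σ => ⨆ k, ∑ j, sgn (σ j) * f k j (z j).1), ← signAvg_add]
    refine signAvg_mono fun σ => ciSup_le fun k => ?_
    have e : ∑ j, sgn (σ j) * (f k j (z j).2 - f k j (z j).1) =
        ∑ j, sgn (σ j) * f k j (z j).2 + ∑ j, sgn (!σ j) * f k j (z j).1 := by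
      rw [← Finset.sum_add_distrib]
      exact Finset.sum_congr rfl fun j _ => by rw [sgn_not]; ring
    rw [e]
    exact add_le_add
      (le_ciSup (bddAbove_range_of_abs_le (hone σ fun j => (z j).2)) k)
      (le_ciSup (bddAbove_range_of_abs_le (hone (fun j => !σ j) fun j => (z j).1)) k)
  have h4 : ∫ z, H (fun _ => true) z ∂Q = ∫ z, signAvg (fun σ => H σ z) ∂Q := by
    simp only [signAvg]
    rw [integral_div, integral_finsetSum _ fun σ _ => hHi σ]
    rw [Finset.sum_congr rfl fun σ _ => h2 σ]
    simp
  have hU1 := hfst.integrable_comp_of_integrable hU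
  have hU2 := hsnd.integrable_comp_of_integrable hU
  have hUe : ∀ π : (J → Ω × Ω) → J → Ω, MeasurePreserving π Q P →
      ∫ z, U (π z) ∂Q = ∫ S, U S ∂P := by
    intro π hπ
    rw [← hπ.map_eq, integral_map hπ.measurable.aemeasurable
      (by rw [hπ.map_eq]; exact hU.aestronglyMeasurable)]
  have hsi : Integrable (fun z => signAvg fun σ => H σ z) Q := by
    simp only [signAvg]
    exact (integrable_finsetSum _ fun σ _ => hHi σ).div_const _
  refine h1.trans ?_
  rw [h4]
  refine (integral_mono hsi (hU2.add hU1) h3).trans_eq ((integral_add hU2 hU1).trans ?_)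
  simp only [Function.comp_def]
  rw [hUe _ hfst, hUe _ hsnd]
  ring

/-! ### Measurability of the empirical Gaussian complexity -/

section EmpComplexity

variable {α : Type*} {p N : ℕ} {Φ : Set (α → EuclideanSpace ℝ (Fin p))}
  {DX : ℝ}

theorem iSup_eq_iSup_of_pointwise_dense {Φ₀ : Set (α → EuclideanSpace ℝ (Fin p))} (hsub : Φ₀ ⊆ Φ)
    (hne : Φ.Nonempty)
    (hdense : ∀ φ ∈ Φ, ∃ u : ℕ → α → EuclideanSpace ℝ (Fin p),
      (∀ k, u k ∈ Φ₀) ∧ ∀ x, Tendsto (fun k => u k x) atTop (𝓝 (φ x)))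
    {F : (α → EuclideanSpace ℝ (Fin p)) → ℝ} {M : ℝ} (hM : ∀ φ ∈ Φ, |F φ| ≤ M)
    (hF : ∀ (φ : α → EuclideanSpace ℝ (Fin p)) (u : ℕ → α → EuclideanSpace ℝ (Fin p)),
      (∀ x, Tendsto (fun k => u k x) atTop (𝓝 (φ x))) →
      Tendsto (fun k => F (u k)) atTop (𝓝 (F φ))) :
    ⨆ φ : Φ, F φ.1 = ⨆ φ : Φ₀, F φ.1 := by
  have := hne.to_subtype
  have hne0 : Nonempty Φ₀ := by
    obtain ⟨φ, hφ⟩ := hne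
    obtain ⟨u, hu, -⟩ := hdense φ hφ
    exact ⟨⟨u 0, hu 0⟩⟩
  have hb : BddAbove (Set.range fun φ : Φ => F φ.1) := bddAbove_range_of_abs_le fun φ => hM _ φ.2
  have hb0 : BddAbove (Set.range fun φ : Φ₀ => F φ.1) :=
    bddAbove_range_of_abs_le fun φ => hM _ (hsub φ.2)
  refine le_antisymm (ciSup_le fun φ => ?_) (ciSup_le fun φ => le_ciSup hb ⟨φ.1, hsub φ.2⟩)
  obtain ⟨u, hu, hlim⟩ := hdense φ.1 φ.2
  exact le_of_tendsto' (hF _ _ hlim) fun k => le_ciSup hb0 ⟨u k, hu k⟩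

/-- Together with the uniform bound below it gives integrability, without which the integral in
`gaussianComplexity` could be the default value `0`. -/
theorem measurable_empGaussianComplexity [MeasurableSpace α] (hsep : PointwiseSeparable Φ)
    (hmeas : ∀ φ ∈ Φ, Measurable φ) (hne : Φ.Nonempty) (hDX : 0 ≤ DX)
    (hΦ : ∀ φ ∈ Φ, ∀ x, ‖φ x‖ ≤ DX) :
    Measurable fun X : Fin N → α => empGaussianComplexity Φ X := by
  obtain ⟨Φ₀, hsub, hcount, hdense⟩ := hsep
  have := hcount.to_subtype
  have e : ∀ (X : Fin N → α) (g : Fin N × Fin p → ℝ),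
      (⨆ f : Φ, (1 / (N : ℝ)) * ∑ i : Fin N, ∑ k : Fin p, g (i, k) * f.1 (X i) k) =
      ⨆ f : Φ₀, (1 / (N : ℝ)) * ∑ i : Fin N, ∑ k : Fin p, g (i, k) * f.1 (X i) k := by
    intro X g
    refine iSup_eq_iSup_of_pointwise_dense hsub hne hdense
      (F := fun f => (1 / (N : ℝ)) * ∑ i : Fin N, ∑ k : Fin p, g (i, k) * f (X i) k)
      (M := (1 / (N : ℝ)) * (√(Fintype.card (Fin N)) * DX * ∑ i, |g i|)) (fun φ hφ => ?_)
      fun φ u hu => ?_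
    · rw [abs_mul, abs_of_nonneg (by positivity : (0 : ℝ) ≤ 1 / N)]
      gcongr
      have := abs_sum_mul_le_of_norm_le
        (fun φ : Φ => norm_featureVec_le X hDX (hΦ φ.1 φ.2)) g ⟨φ, hφ⟩
      simpa [Fintype.sum_prod_type, featureVec] using this
    · refine Tendsto.const_mul _ (tendsto_finsetSum _ fun i _ => tendsto_finsetSum _ fun k _ =>
        Tendsto.const_mul _ ?_)
      exact ((by fun_prop : Continuous fun v : EuclideanSpace ℝ (Fin p) => v k).tendsto _).comp
        (hu (X i))
  simp only [empGaussianComplexity, e]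
  have hm : Measurable fun q : (Fin N → α) × (Fin N × Fin p → ℝ) =>
      ⨆ f : Φ₀, (1 / (N : ℝ)) * ∑ i : Fin N, ∑ k : Fin p, q.2 (i, k) * f.1 (q.1 i) k := by
    refine Measurable.iSup fun f => Measurable.const_mul (Finset.measurable_sum _ fun i _ =>
      Finset.measurable_sum _ fun k _ => Measurable.mul (by fun_prop) ?_) _
    have hf := hmeas f.1 (hsub f.2)
    have hk : Measurable fun v : EuclideanSpace ℝ (Fin p) => v k := by fun_prop
    exact hk.comp (hf.comp (by fun_prop))
  exact hm.stronglyMeasurable.integral_prod_right'.measurable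

theorem abs_empGaussianComplexity_le (hN : 0 < N) (hne : Φ.Nonempty) (hDX : 0 ≤ DX)
    (hΦ : ∀ φ ∈ Φ, ∀ x, ‖φ x‖ ≤ DX) (X : Fin N → α) :
    |empGaussianComplexity Φ X| ≤
      (√(Fintype.card (Fin N)) * DX * ∫ g, ∑ i, |g i| ∂gaussPi (Fin N × Fin p)) / N := by
  have := hne.to_subtype
  have hbd := fun φ : Φ => norm_featureVec_le X hDX (hΦ φ.1 φ.2)
  have h := gaussWidth_featureVec hN (Equiv.refl _) X Φ hDX hΦ
  have h0 := gaussWidth_nonneg hbd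
  have h1 := gaussWidth_le hbd
  rw [h] at h0 h1
  have hN' : (0 : ℝ) < N := by exact_mod_cast hN
  change 0 ≤ N * empGaussianComplexity Φ X at h0
  change N * empGaussianComplexity Φ X ≤ _ at h1
  rw [abs_of_nonneg (nonneg_of_mul_nonneg_right h0 hN'), le_div_iff₀ hN', mul_comm]
  exact h1

end EmpComplexity

/-- Quadratic growth at a minimizer: compare `f y` with `f` at `(1 - b) x + b y`, divide by `1 - b`,
and let `b` approach `1`. -/
theorem StrongConvexOn.sq_norm_sub_le {E : Type*} [NormedAddCommGroup E] [NormedSpace ℝ E]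
    {s : Set E} {lam : ℝ} {f : E → ℝ} (hf : StrongConvexOn s lam f) (hlam : 0 ≤ lam) {x y : E}
    (hx : x ∈ s) (hy : y ∈ s) (hmin : ∀ z ∈ s, f y ≤ f z) :
    lam / 2 * ‖x - y‖ ^ 2 ≤ f x - f y := by
  obtain ⟨hconv, hineq⟩ := hf
  set K := lam / 2 * ‖x - y‖ ^ 2 with hK
  have hK0 : 0 ≤ K := by positivity
  have key : ∀ b : ℝ, 0 < b → b < 1 → b * K ≤ f x - f y := by
    intro b hb hb1
    have h1 := hineq hx hy (show 0 ≤ 1 - b by linarith) hb.le (by ring)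
    have h2 := hmin _ (hconv hx hy (show 0 ≤ 1 - b by linarith) hb.le (by ring))
    simp only [smul_eq_mul] at h1
    have h3 : (1 - b) * (b * K) ≤ (1 - b) * (f x - f y) := by
      rw [hK]; linarith
    exact le_of_mul_le_mul_left h3 (by linarith)
  by_contra! h
  have h0 : 0 ≤ f x - f y := by
    have := key (1 / 2) (by norm_num) (by norm_num)
    linarith
  have hKp : 0 < K := h0.trans_lt h
  -- This `b` makes `b * K` the midpoint of `f x - f y` and `K`, which exceeds `f x - f y`.
  have := key ((K + (f x - f y)) / (2 * K)) (by positivity)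
    (by rw [div_lt_one (by positivity)]; linarith)
  have e : (K + (f x - f y)) / (2 * K) * K = (K + (f x - f y)) / 2 := by field_simp
  rw [e] at this
  linarith

/-! ### The deviation process and its reduction to a countable class. -/

namespace DomainModel

universe u

variable {𝒳 : Type u} [MeasurableSpace 𝒳] {D p : ℕ} (m : DomainModel 𝒳 D p)

instance isProbabilityMeasure_law (t : Fin D) : IsProbabilityMeasure (m.law t) := by
  have := m.isProb
  have := m.isMarkov
  unfold law
  infer_instance

theorem measurePreserving_fst_law (t : Fin D) : MeasurePreserving Prod.fst (m.law t) m.Px := by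
  have := m.isProb
  have := m.isMarkov
  exact ⟨measurable_fst, Measure.fst_compProd _ _⟩

/-- The loss of the predictor `x ↦ ⟪w, φ x⟫` at the labelled example `z`. -/
noncomputable def exLoss (w : EuclideanSpace ℝ (Fin p)) (φ : 𝒳 → EuclideanSpace ℝ (Fin p))
    (z : 𝒳 × ℝ) : ℝ :=
  m.loss (inner ℝ w (φ z.1)) z.2

/-- The total deviation of the expected losses from the losses on the sample `S`. -/
noncomputable def deviation {T n : ℕ} (src : Fin T → Fin D) (w : Fin T → EuclideanSpace ℝ (Fin p))
    (φ : 𝒳 → EuclideanSpace ℝ (Fin p)) (S : Fin T × Fin n → 𝒳 × ℝ) : ℝ :=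
  ∑ j, (∫ z, m.exLoss (w j.1) φ z ∂m.law (src j.1) - m.exLoss (w j.1) φ (S j))

variable {m}

theorem measurable_exLoss (w : EuclideanSpace ℝ (Fin p)) {φ : 𝒳 → EuclideanSpace ℝ (Fin p)}
    (hφ : Measurable φ) : Measurable (m.exLoss w φ) := by
  have h : Measurable fun z : 𝒳 × ℝ => ((inner ℝ w (φ z.1) : ℝ), z.2) :=
    ((hφ.comp measurable_fst).const_inner).prodMk measurable_snd
  exact m.measurable_loss.comp h

theorem measurable_deviation {T n : ℕ} (src : Fin T → Fin D)
    (w : Fin T → EuclideanSpace ℝ (Fin p)) {φ : 𝒳 → EuclideanSpace ℝ (Fin p)}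
    (hφ : Measurable φ) :
    Measurable fun S : Fin T × Fin n → 𝒳 × ℝ => m.deviation src w φ S :=
  Finset.measurable_sum _ fun j _ =>
    ((measurable_exLoss _ hφ).comp (measurable_pi_apply j)).const_sub _

namespace Regular

variable {B L Wbd DX lam : ℝ}

theorem abs_exLoss_le (hm : m.Regular B L Wbd DX lam)
    (w : EuclideanSpace ℝ (Fin p)) (φ : 𝒳 → EuclideanSpace ℝ (Fin p))
    (z : 𝒳 × ℝ) : |m.exLoss w φ z| ≤ B := by
  rw [exLoss, abs_of_nonneg (hm.loss_nonneg _ _)]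
  exact hm.loss_le _ _

theorem B_nonneg (hm : m.Regular B L Wbd DX lam) : 0 ≤ B :=
  (hm.loss_nonneg 0 0).trans (hm.loss_le 0 0)

theorem L_nonneg (hm : m.Regular B L Wbd DX lam) : 0 ≤ L := by
  have := (abs_nonneg _).trans (hm.loss_lipschitz 1 0 0)
  simpa using this

theorem integrable_exLoss (hm : m.Regular B L Wbd DX lam)
    (t : Fin D) (w : EuclideanSpace ℝ (Fin p))
    {φ : 𝒳 → EuclideanSpace ℝ (Fin p)} (hφ : Measurable φ) :
    Integrable (m.exLoss w φ) (m.law t) :=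
  integrable_of_abs_le (measurable_exLoss w hφ) (hm.abs_exLoss_le w φ)

theorem abs_deviation_le (hm : m.Regular B L Wbd DX lam)
    {T n : ℕ} (src : Fin T → Fin D) (w : Fin T → EuclideanSpace ℝ (Fin p))
    (φ : 𝒳 → EuclideanSpace ℝ (Fin p)) (S : Fin T × Fin n → 𝒳 × ℝ) :
    |m.deviation src w φ S| ≤ Fintype.card (Fin T × Fin n) * (B + B) := by
  refine (Finset.abs_sum_le_sum_abs _ _).trans ((Finset.sum_le_sum fun j _ =>
    (abs_sub _ _).trans (add_le_add (abs_integral_le_of_abs_le (hm.abs_exLoss_le _ _))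
      (hm.abs_exLoss_le _ _ _))).trans_eq ?_)
  simp
  ring

theorem tendsto_exLoss (hm : m.Regular B L Wbd DX lam)
    {w : ℕ → EuclideanSpace ℝ (Fin p)} {w₀ : EuclideanSpace ℝ (Fin p)}
    (hw : Tendsto w atTop (𝓝 w₀)) {φ : ℕ → 𝒳 → EuclideanSpace ℝ (Fin p)}
    {φ₀ : 𝒳 → EuclideanSpace ℝ (Fin p)} (z : 𝒳 × ℝ)
    (hφ : Tendsto (fun k => φ k z.1) atTop (𝓝 (φ₀ z.1))) :
    Tendsto (fun k => m.exLoss (w k) (φ k) z) atTop (𝓝 (m.exLoss w₀ φ₀ z)) := by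
  have hc : Continuous fun u => m.loss u z.2 :=
    (LipschitzWith.of_dist_le_mul (K := ⟨L, hm.L_nonneg⟩) fun u u' => by
      rw [Real.dist_eq, Real.dist_eq]; exact hm.loss_lipschitz u u' z.2).continuous
  exact (hc.tendsto _).comp (hw.inner hφ)

/-- Dominated convergence with the constant bound `B`. This continuity lets a countable subclass
compute the supremum, which makes it measurable. -/
theorem tendsto_deviation (hm : m.Regular B L Wbd DX lam)
    {T n : ℕ} (src : Fin T → Fin D)
    {w : ℕ → Fin T → EuclideanSpace ℝ (Fin p)} {w₀ : Fin T → EuclideanSpace ℝ (Fin p)}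
    (hw : ∀ t, Tendsto (fun k => w k t) atTop (𝓝 (w₀ t))) {φ : ℕ → 𝒳 → EuclideanSpace ℝ (Fin p)}
    {φ₀ : 𝒳 → EuclideanSpace ℝ (Fin p)} (hφm : ∀ k, Measurable (φ k))
    (hφ : ∀ x, Tendsto (fun k => φ k x) atTop (𝓝 (φ₀ x))) (S : Fin T × Fin n → 𝒳 × ℝ) :
    Tendsto (fun k => m.deviation src (w k) (φ k) S) atTop (𝓝 (m.deviation src w₀ φ₀ S)) := by
  refine tendsto_finsetSum _ fun j _ => Tendsto.sub ?_ (hm.tendsto_exLoss (hw _) _ (hφ _))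
  refine tendsto_integral_of_dominated_convergence (fun _ => B)
    (fun k => (measurable_exLoss _ (hφm k)).aestronglyMeasurable) (integrable_const _)
    (fun k => .of_forall fun z => hm.abs_exLoss_le _ _ z)
    (.of_forall fun z => hm.tendsto_exLoss (hw _) _ (hφ _))

/-- The supremum of the deviations is attained up to arbitrarily small error on a countable
subclass. -/
theorem exists_countable_subclass (hm : m.Regular B L Wbd DX lam)
    {T : ℕ} (hT : 0 < T) (src : Fin T → Fin D) :
    ∃ (κ : Type u) (_ : Countable κ) (_ : Nonempty κ) (w : κ → Fin T → EuclideanSpace ℝ (Fin p))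
      (φ : κ → 𝒳 → EuclideanSpace ℝ (Fin p)), (∀ k t, w k t ∈ m.W) ∧ (∀ k, φ k ∈ m.Φ) ∧
      ∀ (n : ℕ) (S : Fin T × Fin n → 𝒳 × ℝ) (w₀ : Fin T → EuclideanSpace ℝ (Fin p)),
        (∀ t, w₀ t ∈ m.W) → ∀ φ₀ ∈ m.Φ,
        m.deviation src w₀ φ₀ S ≤ ⨆ k, m.deviation src (w k) (φ k) S := by
  obtain ⟨Φ₀, hΦsub, hΦc, hΦd⟩ := m.separable
  obtain ⟨W₀, hWsub, hWc, hWd⟩ :=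
    (TopologicalSpace.IsSeparable.of_separableSpace m.W).exists_countable_dense_subset
  have := hΦc.to_subtype
  have := hWc.to_subtype
  have hWne : Nonempty W₀ := by
    have h := hWd (hm.wStar_mem (src ⟨0, hT⟩))
    exact (closure_nonempty_iff.1 ⟨_, h⟩).to_subtype
  have hΦne : Nonempty Φ₀ := by
    obtain ⟨u, hu, -⟩ := hΦd _ hm.φStar_mem
    exact ⟨⟨u 0, hu 0⟩⟩
  refine ⟨(Fin T → W₀) × Φ₀, inferInstance, inferInstance, fun k t => (k.1 t).1, fun k => k.2.1,
    fun k t => hWsub (k.1 t).2, fun k => hΦsub k.2.2, fun n S w₀ hw₀ φ₀ hφ₀ => ?_⟩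
  obtain ⟨u, hu, hulim⟩ := hΦd φ₀ hφ₀
  choose v hv hvlim using fun t => mem_closure_iff_seq_limit.1 (hWd (hw₀ t))
  have hlim := hm.tendsto_deviation src (w := fun k t => v t k) hvlim
    (fun k => m.measurable_of_mem _ (hΦsub (hu k))) hulim S
  refine le_of_tendsto' hlim fun k => ?_
  exact le_ciSup (f := fun q : (Fin T → W₀) × Φ₀ => m.deviation src (fun t => (q.1 t).1) q.2.1 S)
    (bddAbove_range_of_abs_le fun q => hm.abs_deviation_le src _ _ S)
    (fun t => ⟨v t k, hv t k⟩, ⟨u k, hu k⟩)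

end Regular

end DomainModel

/-! ### Uniform deviation bound, and its transfer to the predictors. -/

namespace DomainModel

universe u

variable {𝒳 : Type u} [MeasurableSpace 𝒳] {D p : ℕ} {m : DomainModel 𝒳 D p}

namespace Regular

variable {B L Wbd DX lam : ℝ}

theorem Wbd_nonneg (hm : m.Regular B L Wbd DX lam) (t : Fin D) : 0 ≤ Wbd :=
  (norm_nonneg _).trans (hm.norm_le _ (hm.wStar_mem t))

theorem DX_nonneg (hm : m.Regular B L Wbd DX lam) : 0 ≤ DX := by
  have := m.isProb
  obtain ⟨x⟩ := nonempty_of_isProbabilityMeasure m.Px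
  exact (norm_nonneg _).trans (hm.feature_le _ hm.φStar_mem x)

/-- The expected supremum of the deviations is bounded by the Gaussian complexities. -/
theorem integral_iSup_deviation_le (hm : m.Regular B L Wbd DX lam) {T n : ℕ} (hT : 0 < T)
    (hn : 0 < n) (src : Fin T → Fin D) {κ : Type u} [Countable κ] [Nonempty κ]
    {w : κ → Fin T → EuclideanSpace ℝ (Fin p)} {φ : κ → 𝒳 → EuclideanSpace ℝ (Fin p)}
    (hw : ∀ k t, w k t ∈ m.W) (hφ : ∀ k, φ k ∈ m.Φ) :
    ∫ S, ⨆ k, m.deviation src (w k) (φ k) S ∂m.sampleLaw src n ≤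
      (n * T : ℝ) * (L * (8 * (Wbd * DX / ((n : ℝ) * T) ^ 2) +
        5520 * (Real.log ((n : ℝ) * T) * (Wbd * gaussianComplexity m.Px (n * T) m.Φ +
          worstGaussianComplexity n m.W m.Φ)))) := by
  have := m.isProb
  have hWb := hm.Wbd_nonneg (src ⟨0, hT⟩)
  have hDX := hm.DX_nonneg
  have hN : 0 < n * T := by positivity
  set ρ : Fin (n * T) ≃ Fin T × Fin n := finProdFinEquiv.symm.trans (Equiv.prodComm _ _)
  have hΦne : m.Φ.Nonempty := ⟨_, hm.φStar_mem⟩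
  have hmp : MeasurePreserving (fun (S : Fin T × Fin n → 𝒳 × ℝ) i => (S (ρ i)).1)
      (m.sampleLaw src n) (Measure.pi fun _ : Fin (n * T) => m.Px) :=
    (measurePreserving_pi (fun i => m.law (src (ρ i).1)) (fun _ => m.Px)
      (fun i => m.measurePreserving_fst_law _)).comp
      (measurePreserving_pi_comp (fun j : Fin T × Fin n => m.law (src j.1)) ρ.injective)
  have hGi : Integrable (fun X : Fin (n * T) → 𝒳 => empGaussianComplexity m.Φ X)
      (Measure.pi fun _ : Fin (n * T) => m.Px) :=
    integrable_of_abs_le (measurable_empGaussianComplexity m.separable m.measurable_of_mem hΦne hDX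
      hm.feature_le) (abs_empGaussianComplexity_le hN hΦne hDX hm.feature_le)
  have hGi' : Integrable (fun S : Fin T × Fin n → 𝒳 × ℝ =>
      empGaussianComplexity m.Φ fun i => (S (ρ i)).1) (m.sampleLaw src n) :=
    hmp.integrable_comp_of_integrable hGi
  have hGe : ∫ S : Fin T × Fin n → 𝒳 × ℝ, empGaussianComplexity m.Φ (fun i => (S (ρ i)).1)
      ∂m.sampleLaw src n = gaussianComplexity m.Px (n * T) m.Φ := by
    rw [gaussianComplexity, ← hmp.map_eq, integral_map hmp.measurable.aemeasurable
      (by rw [hmp.map_eq]; exact hGi.aestronglyMeasurable)]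
  have : IsProbabilityMeasure (m.sampleLaw src n) := by unfold sampleLaw; infer_instance
  set a : ℝ := 4 * (Wbd * DX / ((n : ℝ) * T) ^ 2) with ha
  set b : ℝ := Real.log ((n : ℝ) * T) with hb
  set Gw := worstGaussianComplexity n m.W m.Φ with hGw
  set G : (Fin T × Fin n → 𝒳 × ℝ) → ℝ :=
    fun S => empGaussianComplexity m.Φ fun i => (S (ρ i)).1 with hG
  have hi0 : Integrable (fun S => Wbd * G S + Gw) (m.sampleLaw src n) :=
    (hGi'.const_mul Wbd).add (integrable_const Gw)
  have hi1 : Integrable (fun S => a + 2760 * (b * (Wbd * G S + Gw))) (m.sampleLaw src n) :=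
    (integrable_const a).add ((hi0.const_mul b).const_mul 2760)
  have hi2 : Integrable (fun S => (n * T : ℝ) * (L * (a + 2760 * (b * (Wbd * G S + Gw)))))
      (m.sampleLaw src n) := (hi1.const_mul L).const_mul _
  refine (integral_iSup_sub_le_of_signAvg_le (fun j : Fin T × Fin n => m.law (src j.1))
    (f := fun k j => m.exLoss (w k j.1) (φ k))
    (fun k j => measurable_exLoss _ (m.measurable_of_mem _ (hφ k)))
    (fun k j => hm.abs_exLoss_le _ _) hi2 fun S => ?_).trans_eq ?_
  · exact signAvg_loss_le hT hn hWb hDX hm.L_nonneg hm.norm_le hm.feature_le ρ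
      (fun j => (S j).1) w hw φ hφ (fun j u => m.loss u (S j).2)
      (fun j u u' => hm.loss_lipschitz u u' _)
  · change 2 * ∫ S, (n * T : ℝ) * (L * (a + 2760 * (b * (Wbd * G S + Gw)))) ∂m.sampleLaw src n = _
    rw [integral_const_mul, integral_const_mul, integral_add (integrable_const a)
      ((hi0.const_mul b).const_mul 2760), integral_const, integral_const_mul, integral_const_mul,
      integral_add (hGi'.const_mul Wbd) (integrable_const Gw), integral_const_mul, hGe]
    simp only [integral_const, probReal_univ, one_smul]
    rw [ha]
    ring

/-- With high probability, the excess deviations are uniformly small. -/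
theorem exists_event (hm : m.Regular B L Wbd DX lam) {T n : ℕ} (hT : 0 < T) (hn : 0 < n)
    (src : Fin T → Fin D) {δ : ℝ} (hδ : 0 < δ) (hδ1 : δ < 1) :
    ∃ E : Set (Fin T × Fin n → 𝒳 × ℝ), MeasurableSet E ∧
      ENNReal.ofReal (1 - δ) ≤ m.sampleLaw src n E ∧
      ∀ S ∈ E, ∀ w : Fin T → EuclideanSpace ℝ (Fin p), (∀ t, w t ∈ m.W) → ∀ φ ∈ m.Φ,
        m.deviation src w φ S - m.deviation src (fun t => m.wStar (src t)) m.φStar S ≤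
        (n * T : ℝ) * (5520 * (L * (Wbd * DX / ((n : ℝ) * T) ^ 2 +
          Real.log ((n : ℝ) * T) * (Wbd * gaussianComplexity m.Px (n * T) m.Φ +
            worstGaussianComplexity n m.W m.Φ)) +
          8 * B * Real.sqrt (Real.log (2 / δ) / ((n : ℝ) * T)))) := by
  have : IsProbabilityMeasure (m.sampleLaw src n) := by unfold sampleLaw; infer_instance
  obtain ⟨κ, hκ, hκ', w, φ, hw, hφ, hdom⟩ := hm.exists_countable_subclass hT src
  have hB := hm.B_nonneg
  have hmeas : ∀ k, Measurable fun S : Fin T × Fin n → 𝒳 × ℝ => m.deviation src (w k) (φ k) S :=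
    fun k => measurable_deviation src _ (m.measurable_of_mem _ (hφ k))
  have hmeas0 : Measurable fun S : Fin T × Fin n → 𝒳 × ℝ =>
      m.deviation src (fun t => m.wStar (src t)) m.φStar S :=
    measurable_deviation src _ m.measurable_φStar
  -- Concentrating the difference directly needs one application of McDiarmid; the subtracted term
  -- has mean zero and does not affect the expectation.
  set f : (Fin T × Fin n → 𝒳 × ℝ) → ℝ := fun S => (⨆ k, m.deviation src (w k) (φ k) S) -
    m.deviation src (fun t => m.wStar (src t)) m.φStar S with hf
  have hsm : Measurable fun S : Fin T × Fin n → 𝒳 × ℝ => ⨆ k, m.deviation src (w k) (φ k) S :=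
    Measurable.iSup hmeas
  have hfm : Measurable f := hsm.sub hmeas0
  have hsb : ∀ S : Fin T × Fin n → 𝒳 × ℝ, |⨆ k, m.deviation src (w k) (φ k) S| ≤
      Fintype.card (Fin T × Fin n) * (B + B) :=
    fun S => abs_ciSup_le_of_forall fun k => hm.abs_deviation_le src _ _ S
  have hfb : ∀ S, |f S| ≤ Fintype.card (Fin T × Fin n) * (B + B) +
      Fintype.card (Fin T × Fin n) * (B + B) := fun S =>
    (abs_sub _ _).trans (add_le_add (hsb S) (hm.abs_deviation_le src _ _ S))
  have hdevupd : ∀ (w' : Fin T → EuclideanSpace ℝ (Fin p)) (φ' : 𝒳 → EuclideanSpace ℝ (Fin p))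
      (S : Fin T × Fin n → 𝒳 × ℝ) i y, m.deviation src w' φ' (Function.update S i y) -
        m.deviation src w' φ' S = m.exLoss (w' i.1) φ' (S i) - m.exLoss (w' i.1) φ' y := by
    intro w' φ' S i y
    rw [deviation, deviation, ← Finset.sum_sub_distrib, Finset.sum_eq_single i]
    · simp
    · intro j _ hj
      simp [Function.update_of_ne hj]
    · simp
  -- One changed sample moves each of the two deviations by at most `B`, since losses lie in `[0,
  -- B]`.
  have hfc : ∀ S i y, f (Function.update S i y) - f S ≤ 2 * B := by
    intro S i y
    have h1 : (⨆ k, m.deviation src (w k) (φ k) (Function.update S i y)) ≤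
        (⨆ k, m.deviation src (w k) (φ k) S) +
        (m.deviation src (fun t => m.wStar (src t)) m.φStar (Function.update S i y) -
          m.deviation src (fun t => m.wStar (src t)) m.φStar S) + 2 * B := by
      refine ciSup_le fun k => ?_
      have h2 := hdevupd (w k) (φ k) S i y
      have h3 := hdevupd (fun t => m.wStar (src t)) m.φStar S i y
      have h4 := le_ciSup (bddAbove_range_of_abs_le fun k =>
        hm.abs_deviation_le src (w k) (φ k) S) k
      have h5 := (abs_le.1 (hm.abs_exLoss_le (w k i.1) (φ k) (S i))).2
      have h6 : 0 ≤ m.exLoss (w k i.1) (φ k) y := hm.loss_nonneg _ _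
      have h7 : 0 ≤ m.exLoss (m.wStar (src i.1)) m.φStar (S i) := hm.loss_nonneg _ _
      have h8 := (abs_le.1 (hm.abs_exLoss_le (m.wStar (src i.1)) m.φStar y)).2
      linarith
    simp only [hf]
    linarith
  have hE0 : ∫ S : Fin T × Fin n → 𝒳 × ℝ, m.deviation src (fun t => m.wStar (src t)) m.φStar S
      ∂m.sampleLaw src n = 0 := by
    have hint : ∀ j : Fin T × Fin n, Integrable (fun S : Fin T × Fin n → 𝒳 × ℝ =>
        m.exLoss (m.wStar (src j.1)) m.φStar (S j)) (m.sampleLaw src n) := fun j =>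
      (measurePreserving_eval (fun j : Fin T × Fin n => m.law (src j.1))
        j).integrable_comp_of_integrable (hm.integrable_exLoss _ _ m.measurable_φStar)
    have hint' : ∀ j : Fin T × Fin n, Integrable (fun S : Fin T × Fin n → 𝒳 × ℝ =>
        ∫ z, m.exLoss (m.wStar (src j.1)) m.φStar z ∂m.law (src j.1) -
          m.exLoss (m.wStar (src j.1)) m.φStar (S j)) (m.sampleLaw src n) := fun j =>
      (integrable_const _).sub (hint j)
    simp only [deviation]
    rw [integral_finsetSum _ fun j _ => hint' j]
    refine Finset.sum_eq_zero fun j _ => ?_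
    rw [integral_sub (integrable_const _) (hint j)]
    have : ∫ S : Fin T × Fin n → 𝒳 × ℝ, m.exLoss (m.wStar (src j.1)) m.φStar (S j)
        ∂m.sampleLaw src n = ∫ z, m.exLoss (m.wStar (src j.1)) m.φStar z ∂m.law (src j.1) := by
      rw [← (measurePreserving_eval (fun j : Fin T × Fin n => m.law (src j.1)) j).map_eq,
        integral_map (measurable_pi_apply j).aemeasurable
          (measurable_exLoss _ m.measurable_φStar).aestronglyMeasurable]
      rfl
    rw [this]
    simp
  have hEf : ∫ S, f S ∂m.sampleLaw src n =
      ∫ S, ⨆ k, m.deviation src (w k) (φ k) S ∂m.sampleLaw src n := by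
    rw [hf, integral_sub (integrable_of_abs_le hsm hsb)
      (integrable_of_abs_le hmeas0 fun S => hm.abs_deviation_le src _ _ S), hE0, sub_zero]
  have hsup := hm.integral_iSup_deviation_le hT hn src hw hφ
  rw [← hEf] at hsup
  have htail := measureReal_lt_le_of_bounded_differences
    (fun j : Fin T × Fin n => m.law (src j.1)) hfm hfb (by positivity) hfc hδ hδ1.le
  change (m.sampleLaw src n).real {S | ∫ S, f S ∂m.sampleLaw src n + _ < f S} ≤ δ at htail
  set u := 2 * B * √(Fintype.card (Fin T × Fin n) * Real.log (1 / δ) / 2) with hu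
  have hAm : MeasurableSet {S | ∫ S, f S ∂m.sampleLaw src n + u < f S} :=
    measurableSet_lt measurable_const hfm
  refine ⟨{S | ∫ S, f S ∂m.sampleLaw src n + u < f S}ᶜ, hAm.compl, ?_, ?_⟩
  · rw [ENNReal.ofReal_le_iff_le_toReal (measure_ne_top _ _)]
    change 1 - δ ≤ (m.sampleLaw src n).real _
    rw [probReal_compl_eq_one_sub hAm]
    linarith
  intro S hS w' hw' φ' hφ'
  have hS' : f S ≤ ∫ S, f S ∂m.sampleLaw src n + u := not_lt.1 hS
  have h1 := hdom n S w' hw' φ' hφ'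
  have hNR : (0 : ℝ) < n * T := by positivity
  have hu' : u ≤ (n * T : ℝ) * (8 * B * Real.sqrt (Real.log (2 / δ) / ((n : ℝ) * T))) := by
    have hlog : Real.log (1 / δ) ≤ Real.log (2 / δ) :=
      Real.log_le_log (by positivity) (by gcongr; norm_num)
    have hlog0 : 0 ≤ Real.log (1 / δ) := Real.log_nonneg (by rw [le_div_iff₀ hδ]; linarith)
    have hc : (Fintype.card (Fin T × Fin n) : ℝ) = n * T := by simp [mul_comm]
    have e : (n * T : ℝ) * Real.sqrt (Real.log (2 / δ) / ((n : ℝ) * T)) =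
        √((n * T : ℝ) * Real.log (2 / δ)) := by
      rw [← Real.sqrt_sq hNR.le, ← Real.sqrt_mul (by positivity), Real.sqrt_sq hNR.le]
      congr 1
      field_simp
    calc u ≤ 2 * B * √((n * T : ℝ) * Real.log (2 / δ)) := by
          rw [hu, hc]
          gcongr
          have : (n * T : ℝ) * Real.log (1 / δ) ≤ n * T * Real.log (2 / δ) := by gcongr
          have : 0 ≤ (n * T : ℝ) * Real.log (1 / δ) := by positivity
          linarith
      _ ≤ 8 * B * √((n * T : ℝ) * Real.log (2 / δ)) := by gcongr; norm_num
      _ = _ := by rw [← e]; ring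
  have hA0 : 0 ≤ (n * T : ℝ) * (L * (Wbd * DX / ((n : ℝ) * T) ^ 2)) := by
    have := hm.Wbd_nonneg (src ⟨0, hT⟩)
    have := hm.DX_nonneg
    have := hm.L_nonneg
    positivity
  have hB0 : 0 ≤ (n * T : ℝ) * (8 * B * Real.sqrt (Real.log (2 / δ) / ((n : ℝ) * T))) := by
    positivity
  have hfin : m.deviation src w' φ' S - m.deviation src (fun t => m.wStar (src t)) m.φStar S ≤
      f S := by simp only [hf]; linarith
  refine hfin.trans (hS'.trans ?_)
  -- The nonnegative remainder and confidence terms are inflated to the common factor `5520`.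
  nlinarith [hsup, hu', hA0, hB0]

theorem risk_sub_nonneg (hm : m.Regular B L Wbd DX lam) (t : Fin D) {w : EuclideanSpace ℝ (Fin p)}
    (hw : w ∈ m.W) {φ : 𝒳 → EuclideanSpace ℝ (Fin p)} (hφ : φ ∈ m.Φ) :
    0 ≤ m.risk t w φ - m.risk t (m.wStar t) m.φStar :=
  sub_nonneg.2 (hm.isMin t w hw φ hφ)

theorem integral_exLoss_sub (hm : m.Regular B L Wbd DX lam) (t : Fin D)
    (w w' : EuclideanSpace ℝ (Fin p)) {φ φ' : 𝒳 → EuclideanSpace ℝ (Fin p)} (hφ : φ ∈ m.Φ)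
    (hφ' : φ' ∈ m.Φ) :
    ∫ z, (m.loss (inner ℝ w (φ z.1)) z.2 - m.loss (inner ℝ w' (φ' z.1)) z.2) ∂(m.law t) =
      m.risk t w φ - m.risk t w' φ' :=
  integral_sub (hm.integrable_exLoss t w (m.measurable_of_mem _ hφ))
    (hm.integrable_exLoss t w' (m.measurable_of_mem _ hφ'))

/-- Each infimum is tested at `w t`; realizability bounds the family below, as a real infimum
requires. -/
theorem tard_le (hm : m.Regular B L Wbd DX lam) {T : ℕ} (src : Fin T → Fin D)
    {w : Fin T → EuclideanSpace ℝ (Fin p)} (hw : ∀ t, w t ∈ m.W)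
    {φ : 𝒳 → EuclideanSpace ℝ (Fin p)} (hφ : φ ∈ m.Φ) :
    m.tard src (fun t => m.wStar (src t)) φ m.φStar ≤
      (1 / (T : ℝ)) * ∑ t, (m.risk (src t) (w t) φ -
        m.risk (src t) (m.wStar (src t)) m.φStar) := by
  unfold tard
  gcongr with t
  simp only [hm.integral_exLoss_sub _ _ _ hφ hm.φStar_mem]
  refine ciInf_le (f := fun w' : m.W => m.risk (src t) w'.1 φ -
    m.risk (src t) (m.wStar (src t)) m.φStar) ⟨0, ?_⟩ ⟨w t, hw t⟩
  rintro _ ⟨w', rfl⟩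
  exact hm.risk_sub_nonneg _ w'.2 hφ

theorem abs_risk_sub_le_uard (hm : m.Regular B L Wbd DX lam) (t : Fin D)
    {w : EuclideanSpace ℝ (Fin p)} (hw : w ∈ m.W)
    {φ : 𝒳 → EuclideanSpace ℝ (Fin p)} (hφ : φ ∈ m.Φ) :
    |m.risk t w φ - m.risk t w m.φStar| ≤ m.uard φ m.φStar := by
  unfold uard
  simp only [hm.integral_exLoss_sub _ _ _ hφ hm.φStar_mem]
  have hb : ∀ s : Fin D, BddAbove (Set.range fun w : m.W =>
      |m.risk s w.1 φ - m.risk s w.1 m.φStar|) := fun s => ⟨B + B, by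
    rintro _ ⟨w', rfl⟩
    exact (abs_sub _ _).trans (add_le_add (abs_integral_le_of_abs_le (hm.abs_exLoss_le _ _))
      (abs_integral_le_of_abs_le (hm.abs_exLoss_le _ _)))⟩
  exact (le_ciSup (hb t) ⟨w, hw⟩).trans (le_ciSup (f := fun s : Fin D => ⨆ w : m.W,
    |m.risk s w.1 φ - m.risk s w.1 m.φStar|) (Set.finite_range _).bddAbove t)

/-- Diversity and strong convexity turn a small average excess risk into a small average distance
of the predictors. -/
theorem avg_norm_sub_le (hm : m.Regular B L Wbd DX lam) {T : ℕ} (hT : 0 < T)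
    (src : Fin T → Fin D) {ν ε : ℝ} (hν : 0 < ν)
    (hdiv : m.Diverse src (fun t => m.wStar (src t)) m.φStar ν ε)
    {w : Fin T → EuclideanSpace ℝ (Fin p)} (hw : ∀ t, w t ∈ m.W)
    {φ : 𝒳 → EuclideanSpace ℝ (Fin p)} (hφ : φ ∈ m.Φ) {Δ C : ℝ} (hC : 1 ≤ C)
    (hΔ : (1 / (T : ℝ)) * ∑ t, (m.risk (src t) (w t) φ -
        m.risk (src t) (m.wStar (src t)) m.φStar) ≤ C * Δ) :
    (1 / (T : ℝ)) * ∑ t, ‖w t - m.wStar (src t)‖ ≤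
      √C * (√(2 / lam) * √((1 + 1 / ν) * Δ + ε)) := by
  have hlam := hm.lam_pos
  have hTR : (0 : ℝ) < T := by exact_mod_cast hT
  -- Diversity tested at the true features: `uard` is nonnegative there and `tard` is nonpositive.
  have hε : 0 ≤ ε := by
    have h1 := hdiv _ hm.φStar_mem
    have h2 := hm.tard_le src (fun t => hm.wStar_mem (src t)) hm.φStar_mem
    simp only [sub_self, Finset.sum_const_zero, mul_zero] at h2
    have h3 := (abs_nonneg _).trans
      (hm.abs_risk_sub_le_uard (src ⟨0, hT⟩) (hm.wStar_mem (src ⟨0, hT⟩)) hm.φStar_mem)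
    have h4 := div_nonpos_of_nonpos_of_nonneg h2 hν.le
    linarith
  set e := (1 / (T : ℝ)) * ∑ t, (m.risk (src t) (w t) φ -
        m.risk (src t) (m.wStar (src t)) m.φStar) with he
  have hu : m.uard φ m.φStar ≤ C * Δ / ν + ε :=
    (hdiv φ hφ).trans (by gcongr; exact (hm.tard_le src hw hφ).trans hΔ)
  -- Quadratic growth holds for the risk over `φStar`; `uard` pays for passing to `φ` with the same
  -- predictor.
  have hpt : ∀ t, ‖w t - m.wStar (src t)‖ ^ 2 ≤ 2 / lam * (m.uard φ m.φStar +
      (m.risk (src t) (w t) φ - m.risk (src t) (m.wStar (src t)) m.φStar)) := by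
    intro t
    have h1 := (hm.strongConvex (src t)).sq_norm_sub_le hlam.le (hw t) (hm.wStar_mem (src t))
      fun z hz => hm.isMin _ z hz _ hm.φStar_mem
    have h2 := (abs_le.1 (hm.abs_risk_sub_le_uard (src t) (hw t) hφ)).1
    rw [div_mul_eq_mul_div, le_div_iff₀ hlam]
    linarith
  have hsq : (1 / (T : ℝ)) * ∑ t, ‖w t - m.wStar (src t)‖ ^ 2 ≤
      2 / lam * (m.uard φ m.φStar + e) := by
    calc (1 / (T : ℝ)) * ∑ t, ‖w t - m.wStar (src t)‖ ^ 2
        ≤ (1 / (T : ℝ)) * ∑ t, 2 / lam * (m.uard φ m.φStar +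
          (m.risk (src t) (w t) φ - m.risk (src t) (m.wStar (src t)) m.φStar)) := by
          gcongr with t; exact hpt t
      _ = _ := by
          rw [← Finset.mul_sum, Finset.sum_add_distrib, he]
          simp only [Finset.sum_const, Finset.card_univ, Fintype.card_fin, nsmul_eq_mul]
          field_simp
  have hcs : ((1 / (T : ℝ)) * ∑ t, ‖w t - m.wStar (src t)‖) ^ 2 ≤
      (1 / (T : ℝ)) * ∑ t, ‖w t - m.wStar (src t)‖ ^ 2 := by
    have := sq_sum_le_card_mul_sum_sq (s := Finset.univ) (f := fun t => ‖w t - m.wStar (src t)‖)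
    simp only [Finset.card_univ, Fintype.card_fin] at this
    rw [mul_pow, one_div_pow, one_div, one_div, inv_mul_le_iff₀ (by positivity)]
    refine this.trans_eq ?_
    field_simp
  rw [← Real.sqrt_mul (by positivity), ← Real.sqrt_mul (by positivity)]
  refine Real.le_sqrt_of_sq_le (hcs.trans (hsq.trans ?_))
  rw [mul_left_comm]
  gcongr ?_ * ?_
  -- Since `C ≥ 1` and `ε ≥ 0`, the constant can be pulled out of the whole bracket.
  have h5 : ε ≤ C * ε := le_mul_of_one_le_left hε hC
  have h6 : C * ((1 + 1 / ν) * Δ + ε) = C * Δ / ν + C * Δ + C * ε := by ring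
  rw [h6]
  linarith

/-- The excess risk of an empirical risk minimizer is bounded by its excess deviation. -/
theorem excess_le_deviation (hm : m.Regular B L Wbd DX lam) {T n : ℕ} (hT : 0 < T) (hn : 0 < n)
    (src : Fin T → Fin D) {S : Fin T × Fin n → 𝒳 × ℝ} {w : Fin T → EuclideanSpace ℝ (Fin p)}
    {φ : 𝒳 → EuclideanSpace ℝ (Fin p)} (hERM : m.IsERM S w φ) :
    (n : ℝ) * ∑ t, (m.risk (src t) (w t) φ - m.risk (src t) (m.wStar (src t)) m.φStar) ≤
      m.deviation src w φ S - m.deviation src (fun t => m.wStar (src t)) m.φStar S := by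
  have h := hERM.2.2 (fun t => m.wStar (src t)) (fun t => hm.wStar_mem _) _ hm.φStar_mem
  unfold empRisk at h
  have h' := le_of_mul_le_mul_left h (by positivity)
  have e : ∀ (w : Fin T → EuclideanSpace ℝ (Fin p)) (φ : 𝒳 → EuclideanSpace ℝ (Fin p)),
      m.deviation src w φ S = (n : ℝ) * ∑ t, m.risk (src t) (w t) φ -
        ∑ t : Fin T, ∑ i : Fin n, m.loss (inner ℝ (w t) (φ (S (t, i)).1)) (S (t, i)).2 := by
    intro w φ
    rw [deviation, Finset.sum_sub_distrib, Fintype.sum_prod_type, Fintype.sum_prod_type,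
      Finset.mul_sum]
    congr 1
    exact Finset.sum_congr rfl fun t _ => by simp [risk, exLoss]
  rw [e, e, Finset.sum_sub_distrib]
  linarith

end Regular

end DomainModel

theorem mainTheorem3 :
    ∃ C : ℝ, 0 < C ∧
      ∀ (𝒳 : Type*) [MeasurableSpace 𝒳] (D p : ℕ) (m : DomainModel 𝒳 D p)
        (B L Wbd DX lam : ℝ), m.Regular B L Wbd DX lam →
      ∀ (T n : ℕ), 1 ≤ T → 1 ≤ n →
      ∀ (src : Fin T → Fin D) (ν ε : ℝ), 0 < ν →
        m.Diverse src (fun t => m.wStar (src t)) m.φStar ν ε →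
      ∀ δ : ℝ, 0 < δ → δ < 1 →
      ∃ E : Set (Fin T × Fin n → 𝒳 × ℝ), MeasurableSet E ∧
        ENNReal.ofReal (1 - δ) ≤ m.sampleLaw src n E ∧
        ∀ S ∈ E, ∀ (wHat : Fin T → EuclideanSpace ℝ (Fin p))
          (φHat : 𝒳 → EuclideanSpace ℝ (Fin p)), m.IsERM S wHat φHat →
          (1 / (T : ℝ)) * ∑ t : Fin T, ‖wHat t - m.wStar (src t)‖ ≤
            C * (Real.sqrt (2 / lam) * Real.sqrt
              ((1 + 1 / ν) *
                (L * (Wbd * DX / ((n : ℝ) * T) ^ 2 +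
                    Real.log ((n : ℝ) * T) *
                      (Wbd * gaussianComplexity m.Px (n * T) m.Φ +
                        worstGaussianComplexity n m.W m.Φ)) +
                  8 * B * Real.sqrt (Real.log (2 / δ) / ((n : ℝ) * T))) + ε)) := by
  -- `5520 = 2 * 460 * 6`: symmetrization, chaining and the number of scales. The root appears
  -- because the risk bounds squared distances.
  refine ⟨√5520, by positivity, ?_⟩
  intro 𝒳 _ D p m B L Wbd DX lam hm T n hT hn src ν ε hν hdiv δ hδ hδ1
  obtain ⟨E, hEm, hE, hdev⟩ := hm.exists_event hT hn src hδ hδ1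
  refine ⟨E, hEm, hE, fun S hS wHat φHat hERM => ?_⟩
  refine hm.avg_norm_sub_le hT src hν hdiv hERM.1 hERM.2.1 (by norm_num) ?_
  have h1 := (hm.excess_le_deviation hT hn src hERM).trans (hdev S hS wHat hERM.1 φHat hERM.2.1)
  have hnR : (0 : ℝ) < n := by exact_mod_cast hn
  have hTR : (0 : ℝ) < T := by exact_mod_cast hT
  rw [mul_assoc] at h1
  rw [one_div, inv_mul_le_iff₀ hTR]
  exact le_of_mul_le_mul_left h1 hnR
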